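/- **Setting.** Let $B=\{b_1,\dots,b_r\}$ be a basis of a free group $F_r$. A *multi core graph* is a finite directed graph (possibly empty or disconnected; loops and multiple edges allowed) with edges labelled by $B$, in which every vertex has degree at least $2$ (loops count twice) and no vertex has two outgoing or two incoming edges with the same label. Morphisms are graph morphisms preserving directions and labels; a morphism is *$B$-surjective* ($\twoheadrightarrow$) if it is surjective on vertices and on edges. For a vertex $v$ of $\Gamma$, $\pi_1(\Gamma,v)\le F_r$ is the group of elements read along closed paths at $v$; along a path from $p$ to $v$ reading $u$ one has $u\,\pi_1(\Gamma,v)\,u^{-1}=\pi_1(\Gamma,p)$. Let $\mathrm{sur}_B$ be the collection of $B$-surjective morphisms up to isomorphism of arrows, and let $\mathcal Q_B(\Gamma)$ be the set of $B$-surjective morphisms from $\Gamma$ up to isomorphism of the codomain. For a $B$-surjective $\eta:\Gamma\twoheadrightarrow\Delta$ let $\mathrm{Decomp}_B(\eta)$ be the (finite) set of pairs $\Gamma\overset{\eta_1}{\twoheadrightarrow}\Sigma\overset{\eta_2}{\twoheadrightarrow}\Delta$ with $\eta_2\circ\eta_1=\eta$, up to isomorphism of $\Sigma$ compatible with $\eta_1,\eta_2$.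 The $B$-convolution is $$(f\underset{B}{*}g)(\eta)=\sum_{(\eta_1,\eta_2)\in \mathrm{Decomp}_B(\eta)}f(\eta_1)\,g(\eta_2),$$ for $g:\mathrm{sur}_B\to\mathbb C$ and $f:\mathrm{sur}_B\to\mathbb C$ or $f:\mathcal Q_B(\Gamma)\to\mathbb C$ (in the last case the result is a function on $\mathcal Q_B(\Gamma)$). Let $\delta_B$ be $1$ on isomorphisms and $0$ on other morphisms, and let $\mu_B:\mathrm{sur}_B\to\mathbb C$ be the inverse of the constant function $\mathbf 1$, that is $\mathbf 1*_B\mu_B=\mu_B*_B\mathbf 1=\delta_B$. Let $\vec w=\{w_1,\dots,w_k\}$ be a multi-word: $w_1,\dots,w_k\in F_r\setminus\{1\}$, considered up to conjugation. Its graph $\Gamma_B(\vec w)$ is the disjoint union of $k$ labelled cycles, the $j$-th one spelling the cyclic reduction of $w_j$. Let $G$ be a finite group and let $\zeta_1,\dots,\zeta_k:G\to\mathbb C$ be class functions. For a morphism $\eta:\Gamma_B(\vec w)\to\Delta$, let $\Delta_1,\dots,\Delta_\ell$ be the components of $\Delta$, let $J_i$ be the fundamental group of $\Delta_i$, and let $f(j)$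 be the index of the component containing the image of the $j$-th cycle, so that $\eta$ conjugates $w_j$ to an element, again denoted $w_j$, of $J_{f(j)}$. Put $$\mathbb E_\eta[\zeta]=\prod_{i=1}^{\ell}\ \mathbb E_{\alpha_i\sim U(\mathrm{Hom}(J_i,G))}\Big[\prod_{j:\,f(j)=i}\zeta_j(\alpha_i(w_j))\Big].$$ For $n\ge 0$ let $G\wr S_n=G^n\rtimes S_n$ and let $\mathrm{Ind}\,\zeta=(\mathrm{Ind}\,\zeta_1,\dots,\mathrm{Ind}\,\zeta_k)$, where $$(\mathrm{Ind}\,\zeta_j)(v,\sigma)=\sum_{i:\ \sigma(i)=i}\zeta_j(v(i));$$ for $n\ge1$ this is the class function on $G\wr S_n$ induced from the function $(v,\sigma)\mapsto\zeta_j(v(n))$ on the stabilizer $G^n\rtimes S_{n-1}$ of the point $n$. For an arbitrary $B$-surjective morphism $\eta:\Gamma\to\Delta$ put $$\mathbb E_\eta[\mathrm{Ind}\,\mathbf 1]=\mathbb E_\eta[S_n\curvearrowright[n]]=\prod_{J}\ \mathbb E_{\alpha\sim U(\mathrm{Hom}(J,S_n))}\Big[\prod_{H\in\eta^{-1}(J)}\#\{\text{common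 fixed points of }\alpha(H)\text{ in }[n]\}\Big],$$ where $J$ runs over the fundamental groups of the components of $\Delta$, and $H\le J$ over the (suitably conjugated) fundamental groups of the components of $\Gamma$ mapped to that component. Finally let $L^B(n)=\mu_B*_B\mathbb E[\mathrm{Ind}\,\mathbf 1]:\mathrm{sur}_B\to\mathbb C$. **Lemma (Induction-Convolution Lemma).** The constant function $\mathbf 1$ on $\mathrm{sur}_B$ has a two-sided $B$-convolution inverse $\mu_B$, and for every multi-word $\vec w$, every finite group $G$, all class functions $\zeta$ as above and every $n\ge0$, $$\mathbb E[\mathrm{Ind}\,\zeta]=\mathbb E[\zeta]\underset{B}{*}\mu_B\underset{B}{*}\mathbb E[\mathrm{Ind}\,\mathbf 1]$$ as functions on $\mathcal Q_B(\Gamma_B(\vec w))$. Equivalently, for every $B$-surjective morphism $\eta$ from $\Gamma_B(\vec w)$ to a multi core graph, $$\mathbb E_\eta[\mathrm{Ind}\,\zeta]=\sum_{(\eta_1,\eta_2)\in\mathrm{Decomp}_B(\eta)}\mathbb E_{\eta_1}[\zeta]\cdot L^B_{\eta_2}(n).$$ -/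

import Mathlib

open scoped CategoryTheory

noncomputable section

namespace ICL

/-! ## Class functions and wreath products -/

/-- The complex-valued class functions on a group. -/
def ClassFn (K : Type*) [Group K] : Type _ :=
  {f : K → ℂ // ∀ g h : K, f (g * h * g⁻¹) = f h}

instance (K : Type*) [Group K] : CoeFun (ClassFn K) fun _ => K → ℂ := ⟨Subtype.val⟩

/-- The wreath product `G ≀ S_n = G^n ⋊ S_n`, where `(σ.v) i = v (σ⁻¹ i)` and
`(v₁, σ₁) (v₂, σ₂) = (v₁ (σ₁.v₂), σ₁ σ₂)`. -/
abbrev Wreath (G : Type*) [Group G] (n : ℕ) : Type _ :=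
  (Fin n → G) ⋊[mulAutArrow] Equiv.Perm (Fin n)

theorem conj_left_apply {G : Type*} [Group G] {n : ℕ} (g x : Wreath G n) (i : Fin n)
    (hi : x.right (g.right⁻¹ i) = g.right⁻¹ i) :
    (g * x * g⁻¹).left i = g.left i * x.left (g.right⁻¹ i) * (g.left i)⁻¹ := by
  have hi' : x.right⁻¹ (g.right⁻¹ i) = g.right⁻¹ i := by
    rw [Equiv.Perm.inv_eq_iff_eq, hi]
  have h : ∀ (σ : Equiv.Perm (Fin n)) (v : Fin n → G) (j : Fin n),
      (mulAutArrow σ v : Fin n → G) j = v (σ⁻¹ j) := fun _ _ _ => rfl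
  simp only [SemidirectProduct.mul_left, SemidirectProduct.mul_right, SemidirectProduct.inv_left,
    Pi.mul_apply, h, mul_inv_rev, Equiv.Perm.mul_apply, inv_inv, hi', Pi.inv_apply]
  rw [show g.right (g.right⁻¹ i) = i from g.right.apply_symm_apply i]

/-- The class function `Ind ζ` on `G ≀ S_n`, `(Ind ζ)(v, σ) = ∑_{i : σ i = i} ζ (v i)`. For
`n ≥ 1` it is induced from the class function `(v, σ) ↦ ζ (v i₀)` on the stabilizer
`G ≀_{[n]} S_{n-1}` of a point `i₀`, see `ind_eq_inducedFn`. -/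
def ClassFn.ind {G : Type*} [Group G] (ζ : ClassFn G) (n : ℕ) : ClassFn (Wreath G n) :=
  ⟨fun x => ∑ i : Fin n with x.right i = i, ζ (x.left i), by
    intro g x
    have hm : ∀ i, (g * x * g⁻¹).right i = i ↔ x.right (g.right⁻¹ i) = g.right⁻¹ i := by
      intro i
      change g.right (x.right (g.right⁻¹ i)) = i ↔ _
      rw [Equiv.Perm.eq_inv_iff_eq]
    refine Finset.sum_bij (fun i _ => g.right⁻¹ i) ?_ ?_ ?_ ?_
    · intro i hi
      exact Finset.mem_filter.2 ⟨Finset.mem_univ _, (hm i).1 (Finset.mem_filter.1 hi).2⟩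
    · intro i _ j _ h
      exact g.right⁻¹.injective h
    · intro i hi
      have h : g.right⁻¹ (g.right i) = i := g.right.symm_apply_apply i
      refine ⟨g.right i, Finset.mem_filter.2 ⟨Finset.mem_univ _, (hm _).2 ?_⟩, h⟩
      rw [h]
      exact (Finset.mem_filter.1 hi).2
    · intro i hi
      rw [conj_left_apply g x i ((hm i).1 (Finset.mem_filter.1 hi).2)]
      exact ζ.2 _ _⟩

/-- Frobenius' formula for the class function induced from a subgroup of a finite group. -/
def inducedFn {K : Type*} [Group K] (H : Subgroup K) (φ : H → ℂ) (g : K) : ℂ :=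
  open Classical in
  (∑ᶠ x : K, if h : x⁻¹ * g * x ∈ H then φ ⟨x⁻¹ * g * x, h⟩ else 0) / Nat.card H

/-- The subgroup of the wreath product that fixes the point `i₀`. -/
def pointStabilizer (G : Type*) [Group G] {n : ℕ} (i₀ : Fin n) : Subgroup (Wreath G n) :=
  (MulAction.stabilizer (Equiv.Perm (Fin n)) i₀).comap SemidirectProduct.rightHom

theorem ind_eq_inducedFn {G : Type*} [Group G] [Finite G] (ζ : ClassFn G) {n : ℕ} (i₀ : Fin n)
    (x : Wreath G n) :
    ζ.ind n x = inducedFn (pointStabilizer G i₀) (fun h => ζ (h.1.left i₀)) x := by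
  classical
  have hmem : ∀ y : Wreath G n, y ∈ pointStabilizer G i₀ ↔ y.right i₀ = i₀ := fun _ => Iff.rfl
  have : Finite (Wreath G n) := Finite.of_equiv _ SemidirectProduct.equivProd.symm
  have : Fintype (Wreath G n) := Fintype.ofFinite _
  let f : Fin n → ℂ := fun i => if x.right i = i then ζ (x.left i) else 0
  have h1 : ∀ y : Wreath G n, (if h : y⁻¹ * x * y ∈ pointStabilizer G i₀ then
      ζ ((y⁻¹ * x * y).left i₀) else 0) = f (y.right i₀) := by
    intro y
    have hy : y⁻¹ * x * y ∈ pointStabilizer G i₀ ↔ x.right (y.right i₀) = y.right i₀ := by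
      rw [hmem]
      change y.right⁻¹ (x.right (y.right i₀)) = i₀ ↔ _
      rw [Equiv.Perm.inv_eq_iff_eq]
    simp only [f, hy]
    split_ifs with h
    · have := conj_left_apply y⁻¹ x i₀ (by simpa using h)
      rw [inv_inv] at this
      rw [this, ζ.2]
      simp
    · rfl
  have h2 : ∀ i : Fin n, (Finset.univ.filter fun y : Wreath G n => y.right i₀ = i).card
      = Nat.card (pointStabilizer G i₀) := by
    intro i
    rw [← Fintype.card_subtype, ← Nat.card_eq_fintype_card]
    refine Nat.card_congr (Equiv.subtypeEquiv
      (Equiv.mulLeft (SemidirectProduct.inr (Equiv.swap i i₀) : Wreath G n)) fun y => ?_)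
    rw [hmem]
    change _ ↔ Equiv.swap i i₀ (y.right i₀) = i₀
    rw [Equiv.swap_apply_eq_iff, Equiv.swap_apply_right]
  have h3 : (Nat.card (pointStabilizer G i₀) : ℂ) ≠ 0 :=
    Nat.cast_ne_zero.2 Nat.card_pos.ne'
  unfold inducedFn
  rw [eq_div_iff h3, finsum_congr h1, finsum_eq_sum_of_fintype,
    ← Finset.sum_fiberwise_of_maps_to (s := Finset.univ) (t := Finset.univ)
      (g := fun y : Wreath G n => y.right i₀) (fun _ _ => Finset.mem_univ _)]
  have h4 : ∀ i : Fin n, ∑ y : Wreath G n with y.right i₀ = i, f (y.right i₀)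
      = f i * Nat.card (pointStabilizer G i₀) := by
    intro i
    rw [Finset.sum_congr rfl (g := fun _ => f i) (fun y hy => by
      rw [(Finset.mem_filter.1 hy).2]), Finset.sum_const, h2, nsmul_eq_mul, mul_comm]
  refine Eq.trans ?_ (Finset.sum_congr rfl fun i _ => h4 i).symm
  rw [← Finset.sum_mul]
  congr 1
  change _ = ∑ i : Fin n, if x.right i = i then ζ (x.left i) else 0
  rw [← Finset.sum_filter]
  rfl

/-! ## Multi core graphs -/

/-- A multi core graph with edge labels in `B`: a finite directed `B`-labelled graph (loops and
multiple edges allowed, not necessarily connected, possibly empty), in which no vertex has two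
outgoing or two incoming edges with the same label (the labelling is an immersion to the bouquet
with petals `B`), and in which every vertex has degree at least two (a loop counts twice). -/
structure MultiCoreGraph (B : Type*) where
  V : Type
  E : Type
  finV : Finite V
  finE : Finite E
  src : E → V
  tgt : E → V
  lab : E → B
  src_inj : ∀ e e', src e = src e' → lab e = lab e' → e = e'
  tgt_inj : ∀ e e', tgt e = tgt e' → lab e = lab e' → e = e'
  two_le_degree : ∀ v, 2 ≤ Nat.card {e // src e = v} + Nat.card {e // tgt e = v}

namespace MultiCoreGraph

variable {B : Type*}

instance (Γ : MultiCoreGraph B) : Finite Γ.V := Γ.finV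
instance (Γ : MultiCoreGraph B) : Finite Γ.E := Γ.finE

/-- A morphism of multi core graphs: a graph morphism that preserves directions and labels. -/
@[ext]
structure Hom (Γ Δ : MultiCoreGraph B) where
  onV : Γ.V → Δ.V
  onE : Γ.E → Δ.E
  src_comm : ∀ e, Δ.src (onE e) = onV (Γ.src e)
  tgt_comm : ∀ e, Δ.tgt (onE e) = onV (Γ.tgt e)
  lab_comm : ∀ e, Δ.lab (onE e) = Γ.lab e

instance : CategoryTheory.Category (MultiCoreGraph B) where
  Hom := Hom
  id Γ := ⟨id, id, fun _ => rfl, fun _ => rfl, fun _ => rfl⟩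
  comp f g := ⟨g.onV ∘ f.onV, g.onE ∘ f.onE,
    fun e => by simp [g.src_comm, f.src_comm], fun e => by simp [g.tgt_comm, f.tgt_comm],
    fun e => by simp [g.lab_comm, f.lab_comm]⟩

variable {Γ Δ Λ : MultiCoreGraph B}

theorem id_onV (Γ : MultiCoreGraph B) : (𝟙 Γ : Γ ⟶ Γ).onV = id := rfl
theorem id_onE (Γ : MultiCoreGraph B) : (𝟙 Γ : Γ ⟶ Γ).onE = id := rfl
theorem comp_onV (f : Γ ⟶ Δ) (g : Δ ⟶ Λ) : (f ≫ g).onV = g.onV ∘ f.onV := rfl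
theorem comp_onE (f : Γ ⟶ Δ) (g : Δ ⟶ Λ) : (f ≫ g).onE = g.onE ∘ f.onE := rfl

theorem hom_ext' {f g : Γ ⟶ Δ} (h : f.onV = g.onV) (h' : f.onE = g.onE) : f = g :=
  Hom.ext h h'

/-- `B`-surjectivity: surjective on vertices and on edges. -/
def Surj (η : Γ ⟶ Δ) : Prop :=
  Function.Surjective η.onV ∧ Function.Surjective η.onE

theorem Surj.comp {f : Γ ⟶ Δ} {g : Δ ⟶ Λ} (hf : Surj f) (hg : Surj g) : Surj (f ≫ g) :=
  ⟨hg.1.comp hf.1, hg.2.comp hf.2⟩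

theorem surj_id (Γ : MultiCoreGraph B) : Surj (𝟙 Γ) :=
  ⟨Function.surjective_id, Function.surjective_id⟩

theorem surj_iso (φ : Γ ≅ Δ) : Surj φ.hom := by
  constructor
  · intro v
    exact ⟨φ.inv.onV v, congrFun (congrArg Hom.onV φ.inv_hom_id) v⟩
  · intro e
    exact ⟨φ.inv.onE e, congrFun (congrArg Hom.onE φ.inv_hom_id) e⟩

/-! ## Paths, components and labelled fundamental groups -/

/-- `Γ.Reads L u v`: the word `L` is read along a path of `Γ` from `u` to `v`; the letter
`(b, true)` is a `b`-edge crossed in its direction, `(b, false)` a `b`-edge crossed against it. -/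
inductive Reads (Γ : MultiCoreGraph B) : List (B × Bool) → Γ.V → Γ.V → Prop
  | nil (v : Γ.V) : Reads Γ [] v v
  | pos (e : Γ.E) {L : List (B × Bool)} {v : Γ.V} (h : Reads Γ L (Γ.tgt e) v) :
      Reads Γ ((Γ.lab e, true) :: L) (Γ.src e) v
  | neg (e : Γ.E) {L : List (B × Bool)} {v : Γ.V} (h : Reads Γ L (Γ.src e) v) :
      Reads Γ ((Γ.lab e, false) :: L) (Γ.tgt e) v

theorem Reads.append {L M : List (B × Bool)} {u v w : Γ.V} (h : Γ.Reads L u v)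
    (h' : Γ.Reads M v w) : Γ.Reads (L ++ M) u w := by
  induction h with
  | nil v => exact h'
  | pos e _ ih => exact Reads.pos e (ih h')
  | neg e _ ih => exact Reads.neg e (ih h')

theorem Reads.invRev {L : List (B × Bool)} {u v : Γ.V} (h : Γ.Reads L u v) :
    Γ.Reads (FreeGroup.invRev L) v u := by
  induction h with
  | nil v => exact Reads.nil v
  | @pos e L v _ ih =>
    have : Γ.Reads [(Γ.lab e, false)] (Γ.tgt e) (Γ.src e) := Reads.neg e (Reads.nil _)
    simpa [FreeGroup.invRev] using ih.append this
  | @neg e L v _ ih =>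
    have : Γ.Reads [(Γ.lab e, true)] (Γ.src e) (Γ.tgt e) := Reads.pos e (Reads.nil _)
    simpa [FreeGroup.invRev] using ih.append this

theorem Reads.map (η : Γ ⟶ Δ) {L : List (B × Bool)} {u v : Γ.V} (h : Γ.Reads L u v) :
    Δ.Reads L (η.onV u) (η.onV v) := by
  induction h with
  | nil v => exact Reads.nil _
  | @pos e L v _ ih =>
    rw [← η.src_comm, ← η.lab_comm]
    rw [← η.tgt_comm] at ih
    exact Reads.pos _ ih
  | @neg e L v _ ih =>
    rw [← η.tgt_comm, ← η.lab_comm]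
    rw [← η.src_comm] at ih
    exact Reads.neg _ ih

/-- The elements of the free group on `B` that are read along paths from `u` to `v`. -/
def pathLabels (Γ : MultiCoreGraph B) (u v : Γ.V) : Set (FreeGroup B) :=
  {g | ∃ L, Γ.Reads L u v ∧ FreeGroup.mk L = g}

theorem one_mem_pathLabels (u : Γ.V) : 1 ∈ Γ.pathLabels u u :=
  ⟨[], Reads.nil u, rfl⟩

theorem mul_mem_pathLabels {u v w : Γ.V} {g h : FreeGroup B} (hg : g ∈ Γ.pathLabels u v)
    (hh : h ∈ Γ.pathLabels v w) : g * h ∈ Γ.pathLabels u w := by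
  obtain ⟨L, hL, rfl⟩ := hg
  obtain ⟨M, hM, rfl⟩ := hh
  exact ⟨L ++ M, hL.append hM, FreeGroup.mul_mk.symm⟩

theorem inv_mem_pathLabels {u v : Γ.V} {g : FreeGroup B} (hg : g ∈ Γ.pathLabels u v) :
    g⁻¹ ∈ Γ.pathLabels v u := by
  obtain ⟨L, hL, rfl⟩ := hg
  exact ⟨_, hL.invRev, FreeGroup.inv_mk.symm⟩

theorem map_mem_pathLabels (η : Γ ⟶ Δ) {u v : Γ.V} {g : FreeGroup B}
    (hg : g ∈ Γ.pathLabels u v) : g ∈ Δ.pathLabels (η.onV u) (η.onV v) := by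
  obtain ⟨L, hL, rfl⟩ := hg
  exact ⟨L, hL.map η, rfl⟩

/-- The labelled fundamental group of `Γ` at `v`, a subgroup of the free group on `B`. -/
def pi1 (Γ : MultiCoreGraph B) (v : Γ.V) : Subgroup (FreeGroup B) where
  carrier := Γ.pathLabels v v
  mul_mem' := mul_mem_pathLabels
  one_mem' := one_mem_pathLabels v
  inv_mem' := inv_mem_pathLabels

/-- Two vertices are equivalent when they are joined by a path. -/
def compSetoid (Γ : MultiCoreGraph B) : Setoid Γ.V where
  r u v := (Γ.pathLabels u v).Nonempty
  iseqv := ⟨fun u => ⟨1, one_mem_pathLabels u⟩, fun ⟨g, hg⟩ => ⟨g⁻¹, inv_mem_pathLabels hg⟩,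
    fun ⟨g, hg⟩ ⟨h, hh⟩ => ⟨g * h, mul_mem_pathLabels hg hh⟩⟩

/-- The set of connected components of `Γ`. -/
def Comp (Γ : MultiCoreGraph B) : Type := Quotient Γ.compSetoid

instance : Finite Γ.Comp := inferInstanceAs (Finite (Quotient Γ.compSetoid))

/-- The component of a vertex. -/
def comp (Γ : MultiCoreGraph B) (v : Γ.V) : Γ.Comp := Quotient.mk Γ.compSetoid v

/-- A base point of a component. -/
def base (Γ : MultiCoreGraph B) (c : Γ.Comp) : Γ.V := Quotient.out c

theorem comp_base (c : Γ.Comp) : Γ.comp (Γ.base c) = c := Quotient.out_eq c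

theorem comp_eq_iff {u v : Γ.V} : Γ.comp u = Γ.comp v ↔ (Γ.pathLabels u v).Nonempty :=
  ⟨fun h => Quotient.exact h, fun h => Quotient.sound (s := Γ.compSetoid) h⟩

/-- The embedding of fundamental groups induced by a morphism. -/
def pi1Map (η : Γ ⟶ Δ) (v : Γ.V) : Γ.pi1 v →* Δ.pi1 (η.onV v) :=
  Subgroup.inclusion fun _ hg => map_mem_pathLabels η hg

/-- Change of base point along a path from `p` to `v` that reads `u`: the map `x ↦ u x u⁻¹`. -/
def pi1Conj {p v : Γ.V} {u : FreeGroup B} (hu : u ∈ Γ.pathLabels p v) : Γ.pi1 v →* Γ.pi1 p where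
  toFun x := ⟨u * x * u⁻¹,
    mul_mem_pathLabels (mul_mem_pathLabels hu x.2) (inv_mem_pathLabels hu)⟩
  map_one' := by ext; simp
  map_mul' x y := by ext; simp

theorem exists_path_from_base {v : Γ.V} {c : Γ.Comp} (h : Γ.comp v = c) :
    ∃ u, u ∈ Γ.pathLabels (Γ.base c) v :=
  comp_eq_iff.1 ((comp_base c).trans h.symm)

/-! ## Expectations along morphisms -/

/-- The expectation of `F` at a uniformly random element of a finite type. -/
def avg {X : Type*} (F : X → ℂ) : ℂ := (∑ᶠ x, F x) / Nat.card X

theorem avg_equiv {X Y : Type*} (e : X ≃ Y) (F : X → ℂ) (F' : Y → ℂ)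
    (h : ∀ x, F x = F' (e x)) : avg F = avg F' := by
  unfold avg
  rw [finsum_eq_of_bijective e e.bijective h, Nat.card_congr e]

/-- For every component `c` of `Δ`, with fundamental group `J c`, draw independently a uniformly
random homomorphism `α c : J c →* K`, and take the expectation of the product over `j` of the
functionals `Φ j`, where `Φ j` is evaluated at the restriction of `α` to the fundamental group at
the vertex `v j`, which is conjugated into `J c` (with `c` the component of `v j`). -/
def homExpect (Δ : MultiCoreGraph B) (K : Type*) [Group K] {ι : Type*} (v : ι → Δ.V)
    (Φ : ∀ j, (Δ.pi1 (v j) →* K) → ℂ) : ℂ :=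
  ∏ᶠ c : Δ.Comp, avg fun α : Δ.pi1 (Δ.base c) →* K =>
    ∏ᶠ j : {j // Δ.comp (v j) = c},
      Φ j (α.comp (pi1Conj (exists_path_from_base j.2).choose_spec))

/-- `Φ` does not change when the homomorphism is conjugated by an element of the target. -/
def ConjInv {J K : Type*} [Group J] [Group K] (Φ : (J →* K) → ℂ) : Prop :=
  ∀ (k : K) (α : J →* K), Φ ((MulAut.conj k).toMonoidHom.comp α) = Φ α

theorem coe_pi1Map (η : Γ ⟶ Δ) (v : Γ.V) (x : Γ.pi1 v) :
    (pi1Map η v x : FreeGroup B) = x := rfl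

theorem coe_pi1Conj {p v : Γ.V} {u : FreeGroup B} (hu : u ∈ Γ.pathLabels p v) (x : Γ.pi1 v) :
    (pi1Conj hu x : FreeGroup B) = u * x * u⁻¹ := rfl

theorem iso_onV_inv_hom (ψ : Γ ≅ Δ) (v : Γ.V) : ψ.inv.onV (ψ.hom.onV v) = v :=
  congrFun (congrArg Hom.onV ψ.hom_inv_id) v

theorem iso_onV_hom_inv (ψ : Γ ≅ Δ) (v : Δ.V) : ψ.hom.onV (ψ.inv.onV v) = v :=
  congrFun (congrArg Hom.onV ψ.inv_hom_id) v

/-- An isomorphism together with a path induces an isomorphism of fundamental groups. -/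
def pi1Equiv (ψ : Γ ≅ Δ) {p : Δ.V} {v : Γ.V} {u : FreeGroup B}
    (hu : u ∈ Δ.pathLabels p (ψ.hom.onV v)) : Γ.pi1 v ≃* Δ.pi1 p :=
  MulEquiv.ofBijective ((pi1Conj hu).comp (pi1Map ψ.hom v)) (by
    constructor
    · intro x y h
      have h' : u * (x : FreeGroup B) * u⁻¹ = u * y * u⁻¹ := congrArg Subtype.val h
      exact Subtype.ext (mul_left_cancel (mul_right_cancel h'))
    · intro y
      have h1 : u⁻¹ * y * u ∈ Δ.pathLabels (ψ.hom.onV v) (ψ.hom.onV v) :=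
        mul_mem_pathLabels (mul_mem_pathLabels (inv_mem_pathLabels hu) y.2) hu
      have h2 := map_mem_pathLabels ψ.inv h1
      rw [iso_onV_inv_hom] at h2
      refine ⟨⟨_, h2⟩, Subtype.ext ?_⟩
      change u * (u⁻¹ * y * u) * u⁻¹ = (y : FreeGroup B)
      group)

theorem coe_pi1Equiv (ψ : Γ ≅ Δ) {p : Δ.V} {v : Γ.V} {u : FreeGroup B}
    (hu : u ∈ Δ.pathLabels p (ψ.hom.onV v)) (x : Γ.pi1 v) :
    (pi1Equiv ψ hu x : FreeGroup B) = u * x * u⁻¹ := rfl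

theorem comp_onV_eq {u v : Γ.V} (η : Γ ⟶ Δ) (h : Γ.comp u = Γ.comp v) :
    Δ.comp (η.onV u) = Δ.comp (η.onV v) := by
  obtain ⟨g, hg⟩ := comp_eq_iff.1 h
  exact comp_eq_iff.2 ⟨g, map_mem_pathLabels η hg⟩

/-- The bijection of components induced by an isomorphism. -/
def compEquiv (ψ : Γ ≅ Δ) : Γ.Comp ≃ Δ.Comp where
  toFun c := Δ.comp (ψ.hom.onV (Γ.base c))
  invFun c := Γ.comp (ψ.inv.onV (Δ.base c))
  left_inv c := by
    have h := comp_onV_eq ψ.inv (comp_base (Δ.comp (ψ.hom.onV (Γ.base c))))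
    exact h.trans (by rw [iso_onV_inv_hom, comp_base])
  right_inv c := by
    have h := comp_onV_eq ψ.hom (comp_base (Γ.comp (ψ.inv.onV (Δ.base c))))
    exact h.trans (by rw [iso_onV_hom_inv, comp_base])

/-- `homExpect` does not depend on the choices of base points and paths, and is invariant under
isomorphisms of the graph and reindexing. -/
theorem homExpect_congr (ψ : Γ ≅ Δ) {K : Type*} [Group K] {ι ι' : Type*} (e : ι ≃ ι')
    (v : ι → Γ.V) (v' : ι' → Δ.V) (Φ : ∀ j, (Γ.pi1 (v j) →* K) → ℂ)
    (Φ' : ∀ j, (Δ.pi1 (v' j) →* K) → ℂ) (hΦ : ∀ j, ConjInv (Φ j))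
    (h : ∀ j, ∃ (u : FreeGroup B) (hu : u ∈ Δ.pathLabels (v' (e j)) (ψ.hom.onV (v j))),
      ∀ α : Δ.pi1 (v' (e j)) →* K, Φ' (e j) α = Φ j (α.comp (pi1Equiv ψ hu).toMonoidHom)) :
    homExpect Γ K v Φ = homExpect Δ K v' Φ' := by
  unfold homExpect
  refine finprod_eq_of_bijective (compEquiv ψ) (compEquiv ψ).bijective fun c => ?_
  obtain ⟨g, hg⟩ := comp_eq_iff.1 (comp_base (compEquiv ψ c))
  have hcomp : ∀ j, Γ.comp (v j) = c ↔ Δ.comp (v' (e j)) = compEquiv ψ c := by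
    intro j
    obtain ⟨u, hu, -⟩ := h j
    rw [comp_eq_iff.2 ⟨u, hu⟩]
    constructor
    · rintro rfl
      exact comp_onV_eq ψ.hom (comp_base _).symm
    · intro hj
      have := comp_onV_eq ψ.inv hj
      rwa [iso_onV_inv_hom, iso_onV_inv_hom, comp_base] at this
  refine avg_equiv ((pi1Equiv ψ hg).monoidHomCongrLeftEquiv) _ _ fun α => ?_
  refine finprod_eq_of_bijective (e.subtypeEquiv hcomp) (Equiv.bijective _) fun j => ?_
  obtain ⟨u, hu, hu'⟩ := h j.1
  refine Eq.trans ?_ (hu' _).symm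
  have hs := (exists_path_from_base j.2).choose_spec
  have hj' : Δ.comp (v' (e j.1)) = compEquiv ψ c := (hcomp j.1).1 j.2
  have hs' := (exists_path_from_base hj').choose_spec
  set s := (exists_path_from_base j.2).choose
  set s' := (exists_path_from_base hj').choose
  have hm : s' * u * s⁻¹ * g⁻¹ ∈ Δ.pi1 (Δ.base (compEquiv ψ c)) :=
    mul_mem_pathLabels (mul_mem_pathLabels (mul_mem_pathLabels hs' hu)
      (inv_mem_pathLabels (map_mem_pathLabels ψ.hom hs))) (inv_mem_pathLabels hg)
  rw [← hΦ j.1 (α ((pi1Equiv ψ hg).symm ⟨_, hm⟩))]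
  congr 1
  ext x
  change _ * α _ * _⁻¹ = α ((pi1Equiv ψ hg).symm _)
  rw [← map_inv, ← map_mul, ← map_mul]
  congr 1
  rw [MulEquiv.eq_symm_apply, map_mul, map_mul, map_inv, MulEquiv.apply_symm_apply]
  ext
  change s' * u * s⁻¹ * g⁻¹ * (g * (s * x * s⁻¹) * g⁻¹) * (s' * u * s⁻¹ * g⁻¹)⁻¹
    = s' * (u * x * u⁻¹) * s'⁻¹
  group

/-- The expectation of the permutation character of `S_n` acting on `n` points along a morphism
`η : Γ ⟶ Δ`: for every component of `Δ` with fundamental group `J`, take a uniformly random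
homomorphism `α : J →* S_n` and the expectation of the product, over the components of `Γ` that
are mapped to the given one, with fundamental groups `H ≤ J`, of the number of common fixed points
of `α(H)`; multiply over the components of `Δ`. -/
def permExpect (n : ℕ) (η : Γ ⟶ Δ) : ℂ :=
  homExpect Δ (Equiv.Perm (Fin n)) (fun c : Γ.Comp => η.onV (Γ.base c)) fun c α =>
    (Nat.card {x : Fin n // ∀ h : Γ.pi1 (Γ.base c), α (pi1Map η (Γ.base c) h) x = x} : ℂ)

theorem permExpect_congr {Γ' Δ' : MultiCoreGraph B} (n : ℕ) (η : Γ ⟶ Δ) (η' : Γ' ⟶ Δ')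
    (φ : Γ ≅ Γ') (ψ : Δ ≅ Δ') (h : φ.hom ≫ η' = η ≫ ψ.hom) :
    permExpect n η = permExpect n η' := by
  refine homExpect_congr ψ (compEquiv φ) _ _ _ _ ?_ ?_
  · intro c k α
    refine congrArg Nat.cast (Nat.card_congr (Equiv.subtypeEquiv k⁻¹ fun x => ?_))
    refine forall_congr' fun y => ?_
    change k (α _ (k⁻¹ x)) = x ↔ _
    rw [Equiv.Perm.eq_inv_iff_eq]
  · intro c
    obtain ⟨g, hg⟩ := comp_eq_iff.1 (comp_base (compEquiv φ c))
    have h1 : η'.onV (φ.hom.onV (Γ.base c)) = ψ.hom.onV (η.onV (Γ.base c)) :=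
      congrFun (congrArg Hom.onV h) _
    have hu := map_mem_pathLabels η' hg
    rw [h1] at hu
    refine ⟨g, hu, fun α => ?_⟩
    congr 1
    refine Nat.card_congr (Equiv.subtypeEquivRight fun x => ?_)
    refine (Equiv.forall_congr (pi1Equiv φ hg).toEquiv fun {y} => ?_).symm
    rfl

/-! ## Surjective morphisms up to isomorphism, decompositions and convolution -/

/-- A `B`-surjective morphism between multi core graphs. -/
structure SurArrow (B : Type*) where
  dom : MultiCoreGraph B
  cod : MultiCoreGraph B
  hom : dom ⟶ cod
  surj : Surj hom

instance SurArrow.setoid (B : Type*) : Setoid (SurArrow B) where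
  r a b := ∃ (φ : a.dom ≅ b.dom) (ψ : a.cod ≅ b.cod), φ.hom ≫ b.hom = a.hom ≫ ψ.hom
  iseqv := by
    refine ⟨fun a => ⟨CategoryTheory.Iso.refl _, CategoryTheory.Iso.refl _, by simp⟩, ?_, ?_⟩
    · rintro a b ⟨φ, ψ, h⟩
      exact ⟨φ.symm, ψ.symm, by simp [CategoryTheory.Iso.inv_comp_eq, reassoc_of% h]⟩
    · rintro a b c ⟨φ, ψ, h⟩ ⟨φ', ψ', h'⟩
      exact ⟨φ ≪≫ φ', ψ ≪≫ ψ', by simp [h', reassoc_of% h]⟩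

/-- The collection `sur_B` of `B`-surjective morphisms, up to isomorphism of arrows. -/
def SurB (B : Type*) := Quotient (SurArrow.setoid B)

/-- The class in `sur_B` of a `B`-surjective morphism. -/
def SurB.mk (η : Γ ⟶ Δ) (hη : Surj η) : SurB B := Quotient.mk _ ⟨Γ, Δ, η, hη⟩

/-- A `B`-surjective morphism with domain `Γ`. -/
structure SurFrom (Γ : MultiCoreGraph B) where
  cod : MultiCoreGraph B
  hom : Γ ⟶ cod
  surj : Surj hom

instance SurFrom.setoid (Γ : MultiCoreGraph B) : Setoid (SurFrom Γ) where
  r a b := ∃ ψ : a.cod ≅ b.cod, a.hom ≫ ψ.hom = b.hom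
  iseqv := by
    refine ⟨fun a => ⟨CategoryTheory.Iso.refl _, by simp⟩, ?_, ?_⟩
    · rintro a b ⟨ψ, h⟩
      exact ⟨ψ.symm, by simp [← h]⟩
    · rintro a b c ⟨ψ, h⟩ ⟨ψ', h'⟩
      exact ⟨ψ ≪≫ ψ', by simp [← h', ← h]⟩

/-- The set `Q_B(Γ)` of quotients of `Γ`: the `B`-surjective morphisms from `Γ`, up to isomorphism
of the codomain. -/
def QB (Γ : MultiCoreGraph B) := Quotient (SurFrom.setoid Γ)

/-- The class in `Q_B(Γ)` of a `B`-surjective morphism from `Γ`. -/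
def QB.mk (η : Γ ⟶ Δ) (hη : Surj η) : QB Γ := Quotient.mk _ ⟨Δ, η, hη⟩

/-- A decomposition `Γ ↠ mid ↠ Δ` of a morphism into two `B`-surjective morphisms. -/
structure PreDecomp (η : Γ ⟶ Δ) where
  mid : MultiCoreGraph B
  fst : Γ ⟶ mid
  snd : mid ⟶ Δ
  fst_surj : Surj fst
  snd_surj : Surj snd
  fac : fst ≫ snd = η

instance PreDecomp.setoid (η : Γ ⟶ Δ) : Setoid (PreDecomp η) where
  r a b := ∃ θ : a.mid ≅ b.mid, a.fst ≫ θ.hom = b.fst ∧ θ.hom ≫ b.snd = a.snd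
  iseqv := by
    refine ⟨fun a => ⟨CategoryTheory.Iso.refl _, by simp, by simp⟩, ?_, ?_⟩
    · rintro a b ⟨θ, h, h'⟩
      exact ⟨θ.symm, by simp [← h], by simp [← h']⟩
    · rintro a b c ⟨θ, h, h'⟩ ⟨θ', k, k'⟩
      exact ⟨θ ≪≫ θ', by simp [← k, ← h], by simp [k', h']⟩

/-- The set of decompositions of `η` into two `B`-surjective morphisms, up to isomorphism of the
middle object. -/
def Decomp (η : Γ ⟶ Δ) := Quotient (PreDecomp.setoid η)

namespace Decomp

variable {η : Γ ⟶ Δ}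

/-- The first morphism of a decomposition of `η : Γ ⟶ Δ`, as an element of `Q_B(Γ)`. -/
def fstQ : Decomp η → QB Γ :=
  Quotient.lift (fun a => QB.mk a.fst a.fst_surj) fun _ _ ⟨θ, h, _⟩ => Quotient.sound ⟨θ, h⟩

/-- The first morphism of a decomposition, as an element of `sur_B`. -/
def fst : Decomp η → SurB B :=
  Quotient.lift (fun a => SurB.mk a.fst a.fst_surj) fun a b ⟨θ, h, _⟩ =>
    Quotient.sound (s := SurArrow.setoid B)
      ⟨CategoryTheory.Iso.refl _, θ, by
        change 𝟙 Γ ≫ b.fst = a.fst ≫ θ.hom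
        simp [h]⟩

/-- The second morphism of a decomposition, as an element of `sur_B`. -/
def snd : Decomp η → SurB B :=
  Quotient.lift (fun a => SurB.mk a.snd a.snd_surj) fun a b ⟨θ, _, h⟩ =>
    Quotient.sound (s := SurArrow.setoid B)
      ⟨θ, CategoryTheory.Iso.refl _, by
        change θ.hom ≫ b.snd = a.snd ≫ 𝟙 Δ
        simp [h]⟩

/-- Isomorphic arrows have the same decompositions. -/
def congrMap {Γ' Δ' : MultiCoreGraph B} {η' : Γ' ⟶ Δ'} (φ : Γ ≅ Γ') (ψ : Δ ≅ Δ')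
    (h : φ.hom ≫ η' = η ≫ ψ.hom) : Decomp η → Decomp η' :=
  Quotient.map
    (fun a => ⟨a.mid, φ.inv ≫ a.fst, a.snd ≫ ψ.hom, (surj_iso φ.symm).comp a.fst_surj,
      a.snd_surj.comp (surj_iso ψ), by
        rw [CategoryTheory.Category.assoc, reassoc_of% a.fac, ← h, φ.inv_hom_id_assoc]⟩)
    (by
      rintro a b ⟨θ, k, k'⟩
      exact ⟨θ, by simp [← k], by simp [← k']⟩)

/-- Isomorphic arrows have the same decompositions. -/
def congr {Γ' Δ' : MultiCoreGraph B} {η' : Γ' ⟶ Δ'} (φ : Γ ≅ Γ') (ψ : Δ ≅ Δ')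
    (h : φ.hom ≫ η' = η ≫ ψ.hom) : Decomp η ≃ Decomp η' where
  toFun := congrMap φ ψ h
  invFun := congrMap φ.symm ψ.symm (by
    simp [CategoryTheory.Iso.inv_comp_eq, reassoc_of% h])
  left_inv d := by
    induction d using Quotient.inductionOn with
    | h a =>
      exact Quotient.sound ⟨CategoryTheory.Iso.refl _, by simp, by simp⟩
  right_inv d := by
    induction d using Quotient.inductionOn with
    | h a =>
      exact Quotient.sound ⟨CategoryTheory.Iso.refl _, by simp, by simp⟩

theorem fst_congr {Γ' Δ' : MultiCoreGraph B} {η' : Γ' ⟶ Δ'} (φ : Γ ≅ Γ') (ψ : Δ ≅ Δ')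
    (h : φ.hom ≫ η' = η ≫ ψ.hom) (d : Decomp η) : (congr φ ψ h d).fst = d.fst := by
  induction d using Quotient.inductionOn with
  | h a => 
    refine Quotient.sound (s := SurArrow.setoid B) ⟨φ.symm, CategoryTheory.Iso.refl _, ?_⟩
    change φ.inv ≫ a.fst = (φ.inv ≫ a.fst) ≫ 𝟙 _
    simp

theorem snd_congr {Γ' Δ' : MultiCoreGraph B} {η' : Γ' ⟶ Δ'} (φ : Γ ≅ Γ') (ψ : Δ ≅ Δ')
    (h : φ.hom ≫ η' = η ≫ ψ.hom) (d : Decomp η) : (congr φ ψ h d).snd = d.snd := by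
  induction d using Quotient.inductionOn with
  | h a => 
    refine Quotient.sound (s := SurArrow.setoid B) ⟨CategoryTheory.Iso.refl _, ψ.symm, ?_⟩
    change 𝟙 _ ≫ a.snd = (a.snd ≫ ψ.hom) ≫ ψ.inv
    simp

theorem fstQ_congr {Δ' : MultiCoreGraph B} {η' : Γ ⟶ Δ'} (ψ : Δ ≅ Δ')
    (h : (CategoryTheory.Iso.refl Γ).hom ≫ η' = η ≫ ψ.hom) (d : Decomp η) :
    (congr (CategoryTheory.Iso.refl Γ) ψ h d).fstQ = d.fstQ := by
  induction d using Quotient.inductionOn with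
  | h a => 
    refine Quotient.sound (s := SurFrom.setoid Γ) ⟨CategoryTheory.Iso.refl _, ?_⟩
    change (𝟙 _ ≫ a.fst) ≫ 𝟙 _ = a.fst
    simp

end Decomp

/-- A finite graph has finitely many quotients, so a morphism has finitely many decompositions. -/
instance (η : Γ ⟶ Δ) : Finite (Decomp η) := by
  have key : ∀ a b : PreDecomp η,
      (∀ x y, a.fst.onV x = a.fst.onV y ↔ b.fst.onV x = b.fst.onV y) →
      (∀ x y, a.fst.onE x = a.fst.onE y ↔ b.fst.onE x = b.fst.onE y) →
      ∃ f : a.mid ⟶ b.mid, a.fst ≫ f = b.fst := by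
    intro a b hV hE
    have fV : ∀ x, b.fst.onV (Function.surjInv a.fst_surj.1 (a.fst.onV x)) = b.fst.onV x :=
      fun x => (hV _ _).1 (Function.surjInv_eq a.fst_surj.1 _)
    have fE : ∀ x, b.fst.onE (Function.surjInv a.fst_surj.2 (a.fst.onE x)) = b.fst.onE x :=
      fun x => (hE _ _).1 (Function.surjInv_eq a.fst_surj.2 _)
    refine ⟨⟨fun x => b.fst.onV (Function.surjInv a.fst_surj.1 x),
      fun x => b.fst.onE (Function.surjInv a.fst_surj.2 x), ?_, ?_, ?_⟩,
      hom_ext' (funext fV) (funext fE)⟩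
    · intro e
      obtain ⟨e, rfl⟩ := a.fst_surj.2 e
      rw [fE, a.fst.src_comm, fV, b.fst.src_comm]
    · intro e
      obtain ⟨e, rfl⟩ := a.fst_surj.2 e
      rw [fE, a.fst.tgt_comm, fV, b.fst.tgt_comm]
    · intro e
      obtain ⟨e, rfl⟩ := a.fst_surj.2 e
      rw [fE, a.fst.lab_comm, b.fst.lab_comm]
  have cancel : ∀ (a : PreDecomp η) {Z : MultiCoreGraph B} (f g : a.mid ⟶ Z),
      a.fst ≫ f = a.fst ≫ g → f = g := by
    intro a Z f g h
    refine hom_ext' (funext fun x => ?_) (funext fun x => ?_)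
    · obtain ⟨x, rfl⟩ := a.fst_surj.1 x
      exact congrFun (congrArg Hom.onV h) x
    · obtain ⟨x, rfl⟩ := a.fst_surj.2 x
      exact congrFun (congrArg Hom.onE h) x
  let F : PreDecomp η → (Γ.V → Γ.V → Prop) × (Γ.E → Γ.E → Prop) := fun a =>
    (fun x y => a.fst.onV x = a.fst.onV y, fun x y => a.fst.onE x = a.fst.onE y)
  have hF : ∀ a b, F a = F b → (Quotient.mk _ a : Decomp η) = Quotient.mk _ b := by
    intro a b h
    have hV : ∀ x y, a.fst.onV x = a.fst.onV y ↔ b.fst.onV x = b.fst.onV y := fun x y =>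
      iff_of_eq (congrFun (congrFun (congrArg Prod.fst h) x) y)
    have hE : ∀ x y, a.fst.onE x = a.fst.onE y ↔ b.fst.onE x = b.fst.onE y := fun x y =>
      iff_of_eq (congrFun (congrFun (congrArg Prod.snd h) x) y)
    obtain ⟨f, hf⟩ := key a b hV hE
    obtain ⟨g, hg⟩ := key b a (fun x y => (hV x y).symm) fun x y => (hE x y).symm
    refine Quotient.sound ⟨⟨f, g, ?_, ?_⟩, hf, ?_⟩
    · exact cancel a _ _ (by rw [reassoc_of% hf, hg, CategoryTheory.Category.comp_id])
    · exact cancel b _ _ (by rw [reassoc_of% hg, hf, CategoryTheory.Category.comp_id])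
    · exact cancel a _ _ (by rw [reassoc_of% hf, b.fac, a.fac])
  refine Finite.of_injective (fun d : Decomp η => F (Quotient.out d)) fun d d' h => ?_
  exact (Quotient.out_eq d).symm.trans ((hF _ _ h).trans (Quotient.out_eq d'))

/-- The `B`-convolution of two functions on `sur_B`:
`(f * g)(η) = ∑ f(η₁) g(η₂)` over the decompositions `(η₁, η₂)` of `η`. -/
def conv (f g : SurB B → ℂ) : SurB B → ℂ :=
  Quotient.lift (fun a : SurArrow B => ∑ᶠ d : Decomp a.hom, f d.fst * g d.snd) (by
    rintro a b ⟨φ, ψ, h⟩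
    refine finsum_eq_of_bijective (Decomp.congr φ ψ h) (Equiv.bijective _) fun d => ?_
    rw [Decomp.fst_congr, Decomp.snd_congr])

/-- The `B`-convolution of a function on `Q_B(Γ)` with a function on `sur_B`. -/
def convQ (f : QB Γ → ℂ) (g : SurB B → ℂ) : QB Γ → ℂ :=
  Quotient.lift (fun a : SurFrom Γ => ∑ᶠ d : Decomp a.hom, f d.fstQ * g d.snd) (by
    rintro a b ⟨ψ, h⟩
    have h' : (CategoryTheory.Iso.refl Γ).hom ≫ b.hom = a.hom ≫ ψ.hom := by simp [h]
    refine finsum_eq_of_bijective (Decomp.congr _ ψ h') (Equiv.bijective _) fun d => ?_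
    rw [Decomp.fstQ_congr, Decomp.snd_congr])

open Classical in
/-- The function on `sur_B` that is `1` on isomorphisms and `0` on all other morphisms. -/
def delta : SurB B → ℂ := fun c =>
  if ∃ a : SurArrow B, Quotient.mk _ a = c ∧ CategoryTheory.IsIso a.hom then 1 else 0

/-- `μ` is a two-sided inverse of the constant function `1` for the `B`-convolution. -/
def IsMoebius (μ : SurB B → ℂ) : Prop :=
  conv 1 μ = delta ∧ conv μ 1 = delta

/-- The Möbius function `μ_B`: the inverse of the constant function `1` for the
`B`-convolution. -/
def moebius (B : Type*) : SurB B → ℂ := Classical.epsilon IsMoebius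

/-- The function `E[S_n ↷ [n]]` on `sur_B`. -/
def permE (B : Type*) (n : ℕ) : SurB B → ℂ :=
  Quotient.lift (fun a : SurArrow B => permExpect n a.hom) fun _ _ ⟨φ, ψ, h⟩ =>
    permExpect_congr n _ _ φ ψ h

/-- The left Möbius derivation `L^B(n) = μ_B * E[S_n ↷ [n]]`. -/
def leftMoebius (B : Type*) (n : ℕ) : SurB B → ℂ := conv (moebius B) (permE B n)

/-! ## Multi-words -/

theorem val_finRotate {m : ℕ} (t : Fin m) :
    (finRotate m t : ℕ) = if (t : ℕ) + 1 = m then 0 else (t : ℕ) + 1 := by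
  cases m with
  | zero => exact t.elim0
  | succ m =>
    rw [coe_finRotate]
    simp [Fin.ext_iff]

theorem sign_eq_of_finRotate {L : List (B × Bool)} (hL : FreeGroup.IsCyclicallyReduced L)
    (t : Fin L.length) (h : (L.get t).1 = (L.get (finRotate _ t)).1) :
    (L.get t).2 = (L.get (finRotate _ t)).2 := by
  obtain ⟨h1, h2⟩ := hL
  have hrot := val_finRotate t
  split_ifs at hrot with ht
  · refine h2 _ ?_ _ ?_ h
    · rw [List.getLast?_eq_getElem?, ← ht]
      simp
    · rw [List.head?_eq_getElem?, Option.mem_def, List.getElem?_eq_some_iff]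
      exact ⟨t.pos, by simp only [List.get_eq_getElem, hrot]⟩
  · have h3 := List.isChain_iff_getElem.1 h1 t (by have := t.2; omega)
    simp only [List.get_eq_getElem, hrot] at h ⊢
    exact h3 h

section MultiWord

variable [DecidableEq B] {F : Type*} [Group F] (b : FreeGroupBasis B F)

/-- The cyclic reduction, with respect to the basis `b`, of an element of the free group `F`:
the cyclically reduced word in the letters of the basis that represents a conjugate of it. -/
def cycWord (g : F) : List (B × Bool) := FreeGroup.reduceCyclically (b.repr g).toWord

theorem exists_cycWord_conj (g : F) :
    ∃ u : FreeGroup B, u * FreeGroup.mk (cycWord b g) * u⁻¹ = b.repr g := by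
  refine ⟨FreeGroup.mk (FreeGroup.reduceCyclically.conjugator (b.repr g).toWord), ?_⟩
  rw [FreeGroup.inv_mk, FreeGroup.mul_mk, FreeGroup.mul_mk, cycWord,
    FreeGroup.reduceCyclically.conj_conjugator_reduceCyclically, FreeGroup.mk_toWord]

theorem length_cycWord_pos {g : F} (hg : g ≠ 1) : 0 < (cycWord b g).length := by
  rw [List.length_pos_iff]
  intro h
  obtain ⟨u, hu⟩ := exists_cycWord_conj b g
  rw [h, ← FreeGroup.one_eq_mk, mul_one, mul_inv_cancel] at hu
  exact hg (b.repr.map_eq_one_iff.1 hu.symm)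

theorem isCyclicallyReduced_cycWord (g : F) : FreeGroup.IsCyclicallyReduced (cycWord b g) :=
  FreeGroup.reduceCyclically.isCyclicallyReduced FreeGroup.isReduced_toWord

variable {k : ℕ} (w : Fin k → F)

/-- The letter of an edge of the cycles of `w`. -/
def letter (e : Σ j : Fin k, Fin (cycWord b (w j)).length) : B × Bool :=
  (cycWord b (w e.1)).get e.2

/-- The cyclic successor of a position. -/
def succPos : Equiv.Perm (Σ j : Fin k, Fin (cycWord b (w j)).length) :=
  Equiv.sigmaCongrRight fun _ => finRotate _

theorem sign_succPos (e : Σ j : Fin k, Fin (cycWord b (w j)).length)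
    (h : (letter b w e).1 = (letter b w (succPos b w e)).1) :
    (letter b w e).2 = (letter b w (succPos b w e)).2 :=
  sign_eq_of_finRotate (isCyclicallyReduced_cycWord b (w e.1)) e.2 h

/-- The multi core graph `Γ_B(w)` of a multi-word `w = {w_1, …, w_k}`: a disjoint union of `k`
cycles; the `j`-th cycle has one vertex and one edge for every position of the cyclic reduction of
`w_j`, the edge at position `t` joins the vertices `t` and `t + 1` (cyclically) and carries the
`t`-th letter, being directed from `t + 1` to `t` if the letter is an inverse. -/
def cycleGraph : MultiCoreGraph B where
  V := Σ j : Fin k, Fin (cycWord b (w j)).length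
  E := Σ j : Fin k, Fin (cycWord b (w j)).length
  finV := inferInstance
  finE := inferInstance
  src e := if (letter b w e).2 then e else succPos b w e
  tgt e := if (letter b w e).2 then succPos b w e else e
  lab e := (letter b w e).1
  src_inj e e' h h' := by
    have s := sign_succPos b w e
    have s' := sign_succPos b w e'
    split_ifs at h with h1 h2 h2
    · exact h
    · subst h; exact absurd ((s' h'.symm).trans h1) h2
    · subst h; exact absurd ((s h').trans h2) h1
    · exact (succPos b w).injective h
  tgt_inj e e' h h' := by
    have s := sign_succPos b w e
    have s' := sign_succPos b w e'
    split_ifs at h with h1 h2 h2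
    · exact (succPos b w).injective h
    · subst h; exact absurd ((s h').symm.trans h1) h2
    · subst h; exact absurd ((s' h'.symm).symm.trans h2) h1
    · exact h
  two_le_degree v := by
    rw [← Nat.card_sum]
    refine Nat.succ_le_of_lt (Finite.one_lt_card_iff_nontrivial.2 ?_)
    obtain ⟨u, rfl⟩ := (succPos b w).surjective v
    set v := succPos b w u with hv
    by_cases h1 : (letter b w v).2 <;> by_cases h2 : (letter b w u).2
    · exact ⟨Sum.inl ⟨v, by simp [h1]⟩, Sum.inr ⟨u, by simp [h2, hv]⟩, by simp⟩
    · refine ⟨Sum.inl ⟨v, by simp [h1]⟩, Sum.inl ⟨u, by simp [h2, hv]⟩, fun h => ?_⟩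
      have : v = u := by simpa using h
      rw [this] at h1
      exact h2 h1
    · refine ⟨Sum.inr ⟨v, by simp [h1]⟩, Sum.inr ⟨u, by simp [h2, hv]⟩, fun h => ?_⟩
      have : v = u := by simpa using h
      rw [this] at h1
      exact h1 h2
    · exact ⟨Sum.inr ⟨v, by simp [h1]⟩, Sum.inl ⟨u, by simp [h2, hv]⟩, by simp⟩

variable {w} (hw : ∀ j, w j ≠ 1)

/-- The initial vertex of the `j`-th cycle of `Γ_B(w)`. -/
def start (j : Fin k) : (cycleGraph b w).V := ⟨j, ⟨0, length_cycWord_pos b (hw j)⟩⟩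

theorem reads_cycWord (j : Fin k) :
    (cycleGraph b w).Reads (cycWord b (w j)) (start b hw j) (start b hw j) := by
  have step : ∀ e : Σ j : Fin k, Fin (cycWord b (w j)).length,
      (cycleGraph b w).Reads [letter b w e] e (succPos b w e) := by
    intro e
    cases h : (letter b w e).2 with
    | true =>
      have := Reads.pos (Γ := cycleGraph b w) e (Reads.nil _)
      simp only [cycleGraph, h, if_true] at this
      rwa [show ((letter b w e).1, true) = letter b w e from Prod.ext rfl h.symm] at this
    | false =>
      have := Reads.neg (Γ := cycleGraph b w) e (Reads.nil _)
      simp only [cycleGraph, h] at this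
      rwa [show ((letter b w e).1, false) = letter b w e from Prod.ext rfl h.symm] at this
  have main : ∀ t (ht : t < (cycWord b (w j)).length),
      (cycleGraph b w).Reads ((cycWord b (w j)).take (t + 1)) (start b hw j)
        (succPos b w ⟨j, ⟨t, ht⟩⟩) := by
    intro t
    induction t with
    | zero =>
      intro ht
      have := step ⟨j, ⟨0, ht⟩⟩
      rw [List.take_succ_eq_append_getElem ht]
      exact this
    | succ t ih =>
      intro ht
      have h1 := ih (by omega)
      have h2 : finRotate _ (⟨t, by omega⟩ : Fin (cycWord b (w j)).length) = ⟨t + 1, ht⟩ :=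
        Fin.ext ((val_finRotate _).trans (if_neg (by simp only; omega)))
      change (cycleGraph b w).Reads _ _ ⟨j, finRotate _ ⟨t, _⟩⟩ at h1
      rw [h2] at h1
      rw [List.take_succ_eq_append_getElem ht]
      exact h1.append (step ⟨j, ⟨t + 1, ht⟩⟩)
  have hpos := length_cycWord_pos b (hw j)
  have h1 := main ((cycWord b (w j)).length - 1) (by omega)
  have h2 : finRotate _ (⟨(cycWord b (w j)).length - 1, by omega⟩ :
      Fin (cycWord b (w j)).length) = ⟨0, hpos⟩ :=
    Fin.ext ((val_finRotate _).trans (if_pos (Nat.sub_add_cancel hpos)))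
  change (cycleGraph b w).Reads _ _ ⟨j, finRotate _ ⟨_, _⟩⟩ at h1
  rw [h2, Nat.sub_add_cancel hpos, List.take_length] at h1
  exact h1

/-- The cyclic reduction of `w_j`, a conjugate of `w_j`, as an element of the fundamental group of
`Γ_B(w)` at the initial vertex of the `j`-th cycle (it goes once around this cycle). -/
def loop (j : Fin k) : (cycleGraph b w).pi1 (start b hw j) :=
  ⟨FreeGroup.mk (cycWord b (w j)), _, reads_cycWord b hw j, rfl⟩

end MultiWord

section WordExpectation

variable [DecidableEq B] {F : Type*} [Group F] (b : FreeGroupBasis B F) {k : ℕ} {w : Fin k → F}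
  (hw : ∀ j, w j ≠ 1) {G : Type*} [Group G]

/-- The expectation `E_η[ζ]` of class functions `ζ_1, …, ζ_k` on `G` along a morphism
`η : Γ_B(w) ⟶ Δ`: for every component of `Δ`, with fundamental group `J`, take a uniformly random
homomorphism `α : J →* G` and the expectation of the product of `ζ_j (α (w_j))` over those `j` for
which `w_j` is conjugated by `η` into `J`; multiply over the components of `Δ`. -/
def wordExpect {Δ : MultiCoreGraph B} (η : cycleGraph b w ⟶ Δ) (ζ : Fin k → ClassFn G) : ℂ :=
  homExpect Δ G (fun j => η.onV (start b hw j)) fun j α =>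
    ζ j (α (pi1Map η (start b hw j) (loop b hw j)))

theorem wordExpect_congr {Δ Δ' : MultiCoreGraph B} (η : cycleGraph b w ⟶ Δ)
    (η' : cycleGraph b w ⟶ Δ') (ψ : Δ ≅ Δ') (h : η ≫ ψ.hom = η') (ζ : Fin k → ClassFn G) :
    wordExpect b hw η ζ = wordExpect b hw η' ζ := by
  subst h
  refine homExpect_congr ψ (Equiv.refl _) _ _ _ _ (fun j g α => (ζ j).2 _ _) fun j => ?_
  refine ⟨1, one_mem_pathLabels _, fun α => ?_⟩
  refine congrArg (fun y => ζ j (α y)) (Subtype.ext ?_)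
  change FreeGroup.mk _ = 1 * FreeGroup.mk _ * 1⁻¹
  simp

/-- The function `E[ζ]` on `Q_B(w)`. -/
def wordE (ζ : Fin k → ClassFn G) : QB (cycleGraph b w) → ℂ :=
  Quotient.lift (fun a => wordExpect b hw a.hom ζ) fun _ _ ⟨ψ, h⟩ =>
    wordExpect_congr b hw _ _ ψ h ζ

end WordExpectation

end MultiCoreGraph

end ICL

end

open ICL ICL.MultiCoreGraph

/-!
Replace random homomorphisms by random edge labellings. If `K` is a finite group, then a labelling
of the edges of a graph `Δ` by elements of `K` has a holonomy along every path, and by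
`bijective_holHom` it amounts to a family of homomorphisms from the fundamental groups of the
components to `K`, together with arbitrary holonomies along chosen paths from the base points to
the other vertices. So the holonomies of a uniformly random labelling are independent uniformly
random homomorphisms (`homExpect_eq_avg`).

A labelling `σ` by permutations of `n` points is an `n`-sheeted cover of `Δ`. The common fixed
points that `E_η[Ind 1]` counts are the lifts of `η` to this cover. Every lift factors uniquely as
a surjection onto its image `Σ`, followed by an injective lift of `Σ ↠ Δ`
(`bijective_injLift_comp`). If `I(η)` is the expected number of injective lifts of `η` to a random
cover (`injE`), then `E[Ind 1] = 1 * I`, that is `L^B = μ_B * E[Ind 1] = I` (`permE_eq_conv`,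
`leftMoebius_eq_injE`).

A labelling by `G ≀ S_n` is a cover given by `σ`, together with a labelling of the edges of the
cover by `G`, and `∏ Ind ζ_j` at the holonomies of the cycles is the sum over the lifts of the
cycles of `∏ ζ_j` at their holonomies in `G` (`prod_ind_hol`). A lift sees only the labels on its
image `Σ`, which are independent and uniform, so on average it contributes `E_{η₁}[ζ]` for
`η₁ : Γ_B(w) ↠ Σ`. Grouping the lifts by their images gives `E[Ind ζ] = E[ζ] * I`
(`wordExpect_ind`).

The Möbius function exists because `δ - 1` vanishes on isomorphisms, so that its convolution
powers vanish on morphisms that lose few vertices and edges and the geometric series for the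
inverse of `1` is finite at every morphism (`exists_isMoebius`).
-/

noncomputable section

namespace ICL

namespace MultiCoreGraph

/-! ### Averages over finite types -/

theorem avg_eq_sum {X : Type*} [Fintype X] (F : X → ℂ) :
    avg F = (∑ x, F x) / Fintype.card X := by
  rw [avg, finsum_eq_sum_of_fintype, Nat.card_eq_fintype_card]

theorem avg_prod {X Y : Type*} [Finite X] [Finite Y] (F : X × Y → ℂ) :
    avg F = avg fun x => avg fun y => F (x, y) := by
  have := Fintype.ofFinite X
  have := Fintype.ofFinite Y
  simp only [avg_eq_sum]
  rw [Fintype.sum_prod_type, Fintype.card_prod, ← Finset.sum_div, div_div, Nat.cast_mul,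
    mul_comm (Fintype.card X : ℂ)]

theorem avg_const {X : Type*} [Finite X] [Nonempty X] (c : ℂ) : avg (fun _ : X => c) = c := by
  have := Fintype.ofFinite X
  rw [avg_eq_sum, Finset.sum_const, Finset.card_univ, nsmul_eq_mul, mul_div_cancel_left₀]
  exact Nat.cast_ne_zero.2 Fintype.card_ne_zero

theorem avg_sum {X ι : Type*} [Finite X] [Fintype ι] (F : ι → X → ℂ) :
    (avg fun x => ∑ i, F i x) = ∑ i, avg (F i) := by
  have := Fintype.ofFinite X
  simp only [avg_eq_sum]
  rw [Finset.sum_comm, Finset.sum_div]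

theorem avg_mul_const {X : Type*} [Finite X] (F : X → ℂ) (c : ℂ) :
    (avg fun x => F x * c) = avg F * c := by
  have := Fintype.ofFinite X
  simp only [avg_eq_sum]
  rw [← Finset.sum_mul, div_mul_eq_mul_div]

theorem avg_pi {ι : Type*} [Finite ι] {X : ι → Type*} [∀ i, Finite (X i)] (F : ∀ i, X i → ℂ) :
    (avg fun x : ∀ i, X i => ∏ᶠ i, F i (x i)) = ∏ᶠ i, avg (F i) := by
  classical
  have := Fintype.ofFinite ι
  have := fun i => Fintype.ofFinite (X i)
  simp only [avg_eq_sum, finprod_eq_prod_of_fintype]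
  rw [Finset.prod_div_distrib, Fintype.prod_sum, Fintype.card_pi, Nat.cast_prod]

/-- The restriction of a uniformly random function along an injection is uniformly random. -/
theorem avg_comp_injective {X Y K : Type*} [Finite X] [Finite Y] [Finite K] [Nonempty K]
    {i : X → Y} (hi : Function.Injective i) (F : (X → K) → ℂ) :
    (avg fun y : Y → K => F (y ∘ i)) = avg F := by
  classical
  let e := Equiv.piEquivPiSubtypeProd (fun y => y ∈ Set.range i) (fun _ : Y => K)
  let e' : (X → K) ≃ ({y // y ∈ Set.range i} → K) :=
    (Equiv.ofInjective i hi).arrowCongr (Equiv.refl K)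
  rw [avg_equiv e (fun y : Y → K => F (y ∘ i)) (fun z => F (e'.symm z.1)) fun y => rfl, avg_prod]
  simp only [avg_const]
  exact avg_equiv e'.symm _ _ fun _ => rfl

/-! ### Holonomy of edge labellings -/

section Holonomy

variable {B : Type*} {Γ Δ : MultiCoreGraph B} {K : Type*} [Group K]

theorem exists_perm_apply_eq {X V : Type*} [Finite V] {f g : X → V} (hf : Function.Injective f)
    (hg : Function.Injective g) : ∃ π : Equiv.Perm V, ∀ x, π (f x) = g x := by
  classical
  have := Fintype.ofFinite V
  let e : {v // v ∈ Set.range f} ≃ {v // v ∈ Set.range g} :=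
    (Equiv.ofInjective f hf).symm.trans (Equiv.ofInjective g hg)
  refine ⟨e.extendSubtype, fun x => ?_⟩
  rw [e.extendSubtype_apply_of_mem _ ⟨x, rfl⟩]
  have : (Equiv.ofInjective f hf).symm ⟨f x, x, rfl⟩ = x :=
    (Equiv.ofInjective f hf).symm_apply_apply x
  simp [e, this]

/-- The `b`-edges of a graph form a partial injection of its vertices, which extends to a
permutation. -/
theorem exists_edgePerm (Γ : MultiCoreGraph B) (b : B) :
    ∃ π : Equiv.Perm Γ.V, ∀ e : {e // Γ.lab e = b}, π (Γ.src e) = Γ.tgt e :=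
  exists_perm_apply_eq
    (fun e e' h => Subtype.ext (Γ.src_inj _ _ h (e.2.trans e'.2.symm)))
    (fun e e' h => Subtype.ext (Γ.tgt_inj _ _ h (e.2.trans e'.2.symm)))

open Classical in
/-- The element of `K` that `x` assigns to the `b`-edge with source `v`, and `1` if there is no
such edge. -/
def outLabel (x : Γ.E → K) (b : B) (v : Γ.V) : K :=
  if h : ∃ e, Γ.src e = v ∧ Γ.lab e = b then x h.choose else 1

theorem outLabel_src (x : Γ.E → K) (e : Γ.E) : outLabel x (Γ.lab e) (Γ.src e) = x e := by
  have h : ∃ e', Γ.src e' = Γ.src e ∧ Γ.lab e' = Γ.lab e := ⟨e, rfl, rfl⟩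
  rw [outLabel, dif_pos h, Γ.src_inj _ _ h.choose_spec.1 h.choose_spec.2]

/-- The right action of the free group on `Γ.V × K` in which crossing an edge `e` moves `(src e, k)`
to `(tgt e, k * x e)`. -/
def skewAction (x : Γ.E → K) : FreeGroup B →* (Equiv.Perm (Γ.V × K))ᵐᵒᵖ :=
  FreeGroup.lift fun b => MulOpposite.op
    (Equiv.prodShear (exists_edgePerm Γ b).choose fun v => Equiv.mulRight (outLabel x b v))

/-- The holonomy, along the path from `v` that reads `g`, of the labelling `x` of the edges by
elements of a group. It is only meaningful if there is such a path. -/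
def hol (x : Γ.E → K) (v : Γ.V) (g : FreeGroup B) : K :=
  ((skewAction x g).unop (v, 1)).2

theorem skewAction_of (x : Γ.E → K) (e : Γ.E) (k : K) :
    (skewAction x (FreeGroup.of (Γ.lab e))).unop (Γ.src e, k) = (Γ.tgt e, k * x e) := by
  rw [skewAction, FreeGroup.lift_apply_of]
  change ((exists_edgePerm Γ (Γ.lab e)).choose (Γ.src e), k * outLabel x _ _) = _
  rw [outLabel_src, (exists_edgePerm Γ (Γ.lab e)).choose_spec ⟨e, rfl⟩]

theorem skewAction_mul (x : Γ.E → K) (g h : FreeGroup B) (p : Γ.V × K) :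
    (skewAction x (g * h)).unop p = (skewAction x h).unop ((skewAction x g).unop p) := by
  rw [map_mul]
  rfl

theorem skewAction_inv_eq (x : Γ.E → K) (g : FreeGroup B) {p q : Γ.V × K}
    (h : (skewAction x g).unop p = q) : (skewAction x g⁻¹).unop q = p := by
  rw [← h, ← skewAction_mul, mul_inv_cancel, map_one]
  rfl

theorem mk_cons_true (b : B) (L : List (B × Bool)) :
    FreeGroup.mk ((b, true) :: L) = FreeGroup.of b * FreeGroup.mk L := by
  rw [FreeGroup.of, FreeGroup.mul_mk]
  rfl

theorem mk_cons_false (b : B) (L : List (B × Bool)) :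
    FreeGroup.mk ((b, false) :: L) = (FreeGroup.of b)⁻¹ * FreeGroup.mk L := by
  rw [FreeGroup.of, FreeGroup.inv_mk, FreeGroup.mul_mk]
  rfl

theorem of_lab_mem_pathLabels (e : Γ.E) :
    FreeGroup.of (Γ.lab e) ∈ Γ.pathLabels (Γ.src e) (Γ.tgt e) :=
  ⟨_, Reads.pos e (Reads.nil _), rfl⟩

/-- Induction along paths: a property of path labels that holds for the trivial paths and is
preserved by prefixing an edge, in either direction, holds for all paths. -/
theorem pathLabels_induction {P : Γ.V → Γ.V → FreeGroup B → Prop} (one : ∀ v, P v v 1)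
    (pos : ∀ e v g, g ∈ Γ.pathLabels (Γ.tgt e) v → P (Γ.tgt e) v g →
      P (Γ.src e) v (FreeGroup.of (Γ.lab e) * g))
    (neg : ∀ e v g, g ∈ Γ.pathLabels (Γ.src e) v → P (Γ.src e) v g →
      P (Γ.tgt e) v ((FreeGroup.of (Γ.lab e))⁻¹ * g))
    {u v : Γ.V} {g : FreeGroup B} (hg : g ∈ Γ.pathLabels u v) : P u v g := by
  obtain ⟨L, hL, rfl⟩ := hg
  induction hL with
  | nil v => exact one v
  | pos e h ih => rw [mk_cons_true]; exact pos e _ _ ⟨_, h, rfl⟩ ih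
  | neg e h ih => rw [mk_cons_false]; exact neg e _ _ ⟨_, h, rfl⟩ ih

theorem skewAction_apply (x : Γ.E → K) {u v : Γ.V} {g : FreeGroup B}
    (hg : g ∈ Γ.pathLabels u v) (k : K) :
    (skewAction x g).unop (u, k) = (v, k * hol x u g) := by
  suffices h : ∃ m, ∀ k, (skewAction x g).unop (u, k) = (v, k * m) by
    obtain ⟨m, hm⟩ := h
    rw [hol, hm, hm, one_mul]
  refine pathLabels_induction
    (P := fun u v g => ∃ m, ∀ k, (skewAction x g).unop (u, k) = (v, k * m))
    (fun v => ⟨1, fun k => by rw [map_one, mul_one]; rfl⟩) ?_ ?_ hg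
  · rintro e v g - ⟨m, hm⟩
    exact ⟨x e * m, fun k => by rw [skewAction_mul, skewAction_of, hm, mul_assoc]⟩
  · rintro e v g - ⟨m, hm⟩
    refine ⟨(x e)⁻¹ * m, fun k => ?_⟩
    have := skewAction_inv_eq x _ (skewAction_of x e (k * (x e)⁻¹))
    rw [inv_mul_cancel_right] at this
    rw [skewAction_mul, this, hm, mul_assoc]

theorem hol_mul (x : Γ.E → K) {u v w : Γ.V} {g h : FreeGroup B} (hg : g ∈ Γ.pathLabels u v)
    (hh : h ∈ Γ.pathLabels v w) : hol x u (g * h) = hol x u g * hol x v h := by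
  have := skewAction_mul x g h (u, 1)
  rw [skewAction_apply x (mul_mem_pathLabels hg hh), skewAction_apply x hg,
    skewAction_apply x hh] at this
  simpa using congrArg Prod.snd this

theorem hol_of (x : Γ.E → K) (e : Γ.E) : hol x (Γ.src e) (FreeGroup.of (Γ.lab e)) = x e := by
  rw [hol, skewAction_of, one_mul]

/-- Path labels form a free groupoid on the edges: a function on paths that is multiplicative
under concatenation is the holonomy of its values at the edges. -/
theorem hol_eq_of_mul {x : Γ.E → K} {h : Γ.V → FreeGroup B → K}
    (hmul : ∀ u v w g g', g ∈ Γ.pathLabels u v → g' ∈ Γ.pathLabels v w →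
      h u (g * g') = h u g * h v g')
    (he : ∀ e, h (Γ.src e) (FreeGroup.of (Γ.lab e)) = x e) {u v : Γ.V} {g : FreeGroup B}
    (hg : g ∈ Γ.pathLabels u v) : hol x u g = h u g := by
  have one : ∀ (h : Γ.V → FreeGroup B → K) (_ : ∀ u v w g g', g ∈ Γ.pathLabels u v →
      g' ∈ Γ.pathLabels v w → h u (g * g') = h u g * h v g') (v : Γ.V), h v 1 = 1 := by
    intro h hmul v
    have := hmul v v v 1 1 (one_mem_pathLabels v) (one_mem_pathLabels v)
    rwa [one_mul, left_eq_mul] at this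
  have hol_mul' := fun u v w g g' (hg : g ∈ Γ.pathLabels u v) (hg' : g' ∈ Γ.pathLabels v w) =>
    hol_mul x hg hg'
  have inv : ∀ (h : Γ.V → FreeGroup B → K) (_ : ∀ u v w g g', g ∈ Γ.pathLabels u v →
      g' ∈ Γ.pathLabels v w → h u (g * g') = h u g * h v g') (e : Γ.E),
      h (Γ.tgt e) (FreeGroup.of (Γ.lab e))⁻¹ = (h (Γ.src e) (FreeGroup.of (Γ.lab e)))⁻¹ := by
    intro h hmul e
    have := hmul _ _ _ _ _ (of_lab_mem_pathLabels e) (inv_mem_pathLabels (of_lab_mem_pathLabels e))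
    rw [mul_inv_cancel, one h hmul] at this
    exact (inv_eq_of_mul_eq_one_right this.symm).symm
  refine pathLabels_induction (P := fun u v g => hol x u g = h u g)
    (fun v => by rw [one h hmul, one _ hol_mul']) (fun e v g hg ih => ?_)
    (fun e v g hg ih => ?_) hg
  · rw [hmul _ _ _ _ _ (of_lab_mem_pathLabels e) hg, hol_mul x (of_lab_mem_pathLabels e) hg, ih,
      he, hol_of]
  · have he' := inv_mem_pathLabels (of_lab_mem_pathLabels e)
    rw [hmul _ _ _ _ _ he' hg, hol_mul x he' hg, ih, inv h hmul, inv _ hol_mul', he, hol_of]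

theorem hol_one (x : Γ.E → K) (v : Γ.V) : hol x v 1 = 1 := by
  rw [hol, map_one]
  rfl

theorem hol_inv (x : Γ.E → K) {u v : Γ.V} {g : FreeGroup B} (hg : g ∈ Γ.pathLabels u v) :
    hol x v g⁻¹ = (hol x u g)⁻¹ := by
  have := hol_mul x hg (inv_mem_pathLabels hg)
  rw [mul_inv_cancel, hol_one] at this
  exact (inv_eq_of_mul_eq_one_right this.symm).symm

theorem hol_comp_onE (η : Γ ⟶ Δ) (x : Δ.E → K) {u v : Γ.V} {g : FreeGroup B}
    (hg : g ∈ Γ.pathLabels u v) : hol (x ∘ η.onE) u g = hol x (η.onV u) g := by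
  refine hol_eq_of_mul (h := fun u g => hol x (η.onV u) g) (fun u v w g g' hg hg' => ?_)
    (fun e => ?_) hg
  · exact hol_mul x (map_mem_pathLabels η hg) (map_mem_pathLabels η hg')
  · rw [← η.src_comm, ← η.lab_comm, hol_of]
    rfl

theorem hol_monoidHom {K' : Type*} [Group K'] (φ : K →* K') (x : Γ.E → K) {u v : Γ.V}
    {g : FreeGroup B} (hg : g ∈ Γ.pathLabels u v) : hol (φ ∘ x) u g = φ (hol x u g) :=
  hol_eq_of_mul (h := fun u g => φ (hol x u g))
    (fun u v w g g' hg hg' => by rw [hol_mul x hg hg', map_mul])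
    (fun e => by rw [hol_of]; rfl) hg

/-- The homomorphism from the fundamental group at `v` given by the holonomy of `x`. -/
def holHom (x : Γ.E → K) (v : Γ.V) : Γ.pi1 v →* K where
  toFun g := hol x v g
  map_one' := hol_one x v
  map_mul' g h := hol_mul x g.2 h.2

theorem holHom_apply (x : Γ.E → K) (v : Γ.V) (g : Γ.pi1 v) : holHom x v g = hol x v g := rfl

end Holonomy

/-! ### Random edge labellings and random homomorphisms -/

section Labellings

variable {B : Type*} {Δ : MultiCoreGraph B} {K : Type*} [Group K]

open Classical in
/-- The label of a chosen path from the base point of its component to `v`; at a base point the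
trivial path is chosen. -/
def basePath (v : Δ.V) : FreeGroup B :=
  if Δ.base (Δ.comp v) = v then 1 else (exists_path_from_base (rfl : Δ.comp v = Δ.comp v)).choose

theorem basePath_mem (v : Δ.V) : basePath v ∈ Δ.pathLabels (Δ.base (Δ.comp v)) v := by
  unfold basePath
  split_ifs with h
  · rw [h]
    exact one_mem_pathLabels _
  · exact (exists_path_from_base (rfl : Δ.comp v = Δ.comp v)).choose_spec

theorem basePath_base (c : Δ.Comp) : basePath (Δ.base c) = 1 :=
  if_pos (by rw [comp_base])

theorem basePath_mul_mem {u v : Δ.V} {g : FreeGroup B} (hg : g ∈ Δ.pathLabels u v) :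
    basePath u * g * (basePath v)⁻¹ ∈ Δ.pi1 (Δ.base (Δ.comp u)) := by
  have h := basePath_mem v
  rw [← comp_eq_iff.2 ⟨g, hg⟩] at h
  exact mul_mem_pathLabels (mul_mem_pathLabels (basePath_mem u) hg) (inv_mem_pathLabels h)

open Classical in
/-- The values of a family of homomorphisms at the path from `u` to `v` with label `g`, closed up
to a loop at the base point of the component. -/
def closeUp (α : ∀ c : Δ.Comp, Δ.pi1 (Δ.base c) →* K) (u v : Δ.V) (g : FreeGroup B) : K :=
  if h : basePath u * g * (basePath v)⁻¹ ∈ Δ.pi1 (Δ.base (Δ.comp u)) then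
    α (Δ.comp u) ⟨_, h⟩ else 1

theorem closeUp_mul (α : ∀ c : Δ.Comp, Δ.pi1 (Δ.base c) →* K) {u v w : Δ.V} {g h : FreeGroup B}
    (hg : g ∈ Δ.pathLabels u v) (hh : h ∈ Δ.pathLabels v w) :
    closeUp α u w (g * h) = closeUp α u v g * closeUp α v w h := by
  have key : ∀ (c c' : Δ.Comp) (_ : c = c') (a b : FreeGroup B) (ha : a ∈ Δ.pi1 (Δ.base c))
      (hb : b ∈ Δ.pi1 (Δ.base c')) (hab : a * b ∈ Δ.pi1 (Δ.base c)),
      α c ⟨a * b, hab⟩ = α c ⟨a, ha⟩ * α c' ⟨b, hb⟩ := by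
    rintro c _ rfl a b ha hb hab
    rw [← map_mul]
    rfl
  have h1 := basePath_mul_mem hg
  have h2 := basePath_mul_mem hh
  have h3 := basePath_mul_mem (mul_mem_pathLabels hg hh)
  rw [closeUp, closeUp, closeUp, dif_pos h1, dif_pos h2, dif_pos h3,
    ← key _ _ (comp_eq_iff.2 ⟨g, hg⟩) _ _ h1 h2 (by convert h3 using 1; group)]
  congr 2
  group

theorem closeUp_base (α : ∀ c : Δ.Comp, Δ.pi1 (Δ.base c) →* K) (c : Δ.Comp)
    (g : Δ.pi1 (Δ.base c)) : closeUp α (Δ.base c) (Δ.base c) g = α c g := by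
  have key : ∀ (c c' : Δ.Comp) (_ : c' = c) (a b : FreeGroup B) (_ : a = b)
      (ha : a ∈ Δ.pi1 (Δ.base c')) (hb : b ∈ Δ.pi1 (Δ.base c)),
      α c' ⟨a, ha⟩ = α c ⟨b, hb⟩ := by
    rintro c _ rfl a _ rfl ha hb
    rfl
  rw [closeUp, dif_pos (basePath_mul_mem g.2)]
  exact key _ _ (comp_base c) _ _ (by rw [basePath_base]; simp) _ _

/-- An edge labelling amounts to its holonomies at the base points together with its holonomies
along the chosen paths from the base points to the other vertices. -/
theorem bijective_holHom (Δ : MultiCoreGraph B) (K : Type*) [Group K] :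
    Function.Bijective fun x : Δ.E → K =>
      ((fun c => holHom x (Δ.base c),
        ⟨fun v => hol x (Δ.base (Δ.comp v)) (basePath v), fun c => by
          change hol x _ (basePath (Δ.base c)) = 1
          rw [basePath_base, hol_one]⟩) :
        (∀ c : Δ.Comp, Δ.pi1 (Δ.base c) →* K) × {y : Δ.V → K // ∀ c, y (Δ.base c) = 1}) := by
  have hclose : ∀ (x : Δ.E → K) {u v : Δ.V} {g : FreeGroup B}, g ∈ Δ.pathLabels u v →
      closeUp (fun c => holHom x (Δ.base c)) u v g = hol x (Δ.base (Δ.comp u)) (basePath u) *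
        hol x u g * (hol x (Δ.base (Δ.comp v)) (basePath v))⁻¹ := by
    intro x u v g hg
    have h := basePath_mem v
    have huv := comp_eq_iff.2 ⟨g, hg⟩
    rw [← huv] at h
    rw [closeUp, dif_pos (basePath_mul_mem hg), holHom_apply, hol_mul x
      (mul_mem_pathLabels (basePath_mem u) hg) (inv_mem_pathLabels h), hol_inv x h,
      hol_mul x (basePath_mem u) hg, huv]
  constructor
  · intro x x' h
    have h1 : (fun c => holHom x (Δ.base c)) = fun c => holHom x' (Δ.base c) :=
      congrArg Prod.fst h
    have h2 : ∀ v, hol x (Δ.base (Δ.comp v)) (basePath v)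
        = hol x' (Δ.base (Δ.comp v)) (basePath v) :=
      congrFun (congrArg Subtype.val (congrArg Prod.snd h))
    funext e
    have h3 := hclose x (of_lab_mem_pathLabels e)
    rw [h1, hclose x' (of_lab_mem_pathLabels e), h2, h2] at h3
    rw [← hol_of x e, ← hol_of x' e]
    exact (mul_left_cancel (mul_right_cancel h3)).symm
  · rintro ⟨α, y, hy⟩
    let x : Δ.E → K := fun e => (y (Δ.src e))⁻¹ *
      closeUp α (Δ.src e) (Δ.tgt e) (FreeGroup.of (Δ.lab e)) * y (Δ.tgt e)
    have hx : ∀ {u v : Δ.V} {g : FreeGroup B}, g ∈ Δ.pathLabels u v →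
        hol x u g = (y u)⁻¹ * closeUp α u v g * y v := by
      classical
      intro u v g hg
      -- the end point of a path is determined by its starting point and its label
      let f : Δ.V → FreeGroup B → K := fun u g =>
        if hg : ∃ v, g ∈ Δ.pathLabels u v then
          (y u)⁻¹ * closeUp α u hg.choose g * y hg.choose else 1
      have hend : ∀ {u v v' : Δ.V} {g : FreeGroup B}, g ∈ Δ.pathLabels u v →
          g ∈ Δ.pathLabels u v' → v = v' := by
        intro u v v' g h h'
        have h1 := skewAction_apply (K := K) 1 h 1
        rw [skewAction_apply 1 h'] at h1
        exact (congrArg Prod.fst h1).symm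
      have hf : ∀ {u v : Δ.V} {g : FreeGroup B}, g ∈ Δ.pathLabels u v →
          f u g = (y u)⁻¹ * closeUp α u v g * y v := by
        intro u v g hg
        have he : ∃ v, g ∈ Δ.pathLabels u v := ⟨v, hg⟩
        simp only [f]
        rw [dif_pos he, hend he.choose_spec hg]
      rw [← hf hg]
      refine hol_eq_of_mul (fun u v w g g' hg hg' => ?_)
        (fun e => hf (of_lab_mem_pathLabels e)) hg
      rw [hf hg, hf hg', hf (mul_mem_pathLabels hg hg'), closeUp_mul α hg hg']
      group
    refine ⟨x, Prod.ext (funext fun c => MonoidHom.ext fun g => ?_)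
      (Subtype.ext (funext fun v => ?_))⟩
    · change hol x _ _ = _
      rw [hx g.2, closeUp_base, hy, inv_one, one_mul, mul_one]
    · have hone : closeUp α (Δ.base (Δ.comp v)) v (basePath v) = 1 := by
        rw [closeUp]
        split_ifs with hm
        · have : (⟨_, hm⟩ : Δ.pi1 (Δ.base (Δ.comp (Δ.base (Δ.comp v))))) = 1 := by
            refine Subtype.ext ?_
            simp [basePath_base]
          rw [this, map_one]
        · rfl
      change hol x _ _ = _
      rw [hx (basePath_mem v), hone, hy]
      simp

/-- Taking independent uniformly random homomorphisms from the fundamental groups of the components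
amounts to taking a uniformly random labelling of the edges and its holonomies. -/
theorem homExpect_eq_avg (Δ : MultiCoreGraph B) (K : Type*) [Group K] [Finite K] {ι : Type*}
    [Fintype ι] (v : ι → Δ.V) (Φ : ∀ j, (Δ.pi1 (v j) →* K) → ℂ) (hΦ : ∀ j, ConjInv (Φ j)) :
    homExpect Δ K v Φ = avg fun x : Δ.E → K => ∏ j, Φ j (holHom x (v j)) := by
  classical
  have := Fintype.ofFinite Δ.Comp
  let Y := {y : Δ.V → K // ∀ c, y (Δ.base c) = 1}
  have : Nonempty Y := ⟨⟨1, fun _ => rfl⟩⟩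
  let e := Equiv.ofBijective _ (bijective_holHom Δ K)
  have : Finite ((∀ c : Δ.Comp, Δ.pi1 (Δ.base c) →* K) × Y) := Finite.of_equiv _ e
  have : Finite (∀ c : Δ.Comp, Δ.pi1 (Δ.base c) →* K) :=
    Finite.of_surjective _ (Prod.fst_surjective (β := Y))
  have : ∀ c : Δ.Comp, Finite (Δ.pi1 (Δ.base c) →* K) := fun c =>
    Finite.of_surjective (fun α : ∀ c : Δ.Comp, Δ.pi1 (Δ.base c) →* K => α c)
      (Function.surjective_eval c)
  let F : ∀ c : Δ.Comp, (Δ.pi1 (Δ.base c) →* K) → ℂ := fun c α =>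
    ∏ᶠ j : {j // Δ.comp (v j) = c},
      Φ j (α.comp (pi1Conj (exists_path_from_base j.2).choose_spec))
  change ∏ᶠ c, avg (F c) = _
  rw [← avg_pi]
  refine Eq.trans ?_ (avg_equiv e _ (fun p => ∏ᶠ c, F c (p.1 c)) fun x => ?_).symm
  · rw [avg_prod]
    simp only [avg_const]
  · change _ = ∏ᶠ c, F c (holHom x (Δ.base c))
    simp only [F, finprod_eq_prod_of_fintype]
    rw [← Fintype.prod_fiberwise (fun j => Δ.comp (v j))]
    refine Finset.prod_congr rfl fun c _ => Finset.prod_congr rfl fun j _ => ?_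
    have hs := (exists_path_from_base j.2).choose_spec
    set s := (exists_path_from_base j.2).choose
    rw [← hΦ j.1 (hol x (Δ.base c) s)]
    congr 1
    ext g
    change hol x _ _ * hol x _ _ * (hol x _ _)⁻¹ = hol x _ (s * g * s⁻¹)
    rw [hol_mul x (mul_mem_pathLabels hs g.2) (inv_mem_pathLabels hs), hol_mul x hs g.2,
      hol_inv x hs]

end Labellings

/-! ### Lifts to permutation covers -/

section Lifts

variable {B : Type*} {Γ Δ Λ : MultiCoreGraph B} {n : ℕ}

/-- A labelling `σ` of the edges of `Γ` by permutations of `n` points defines an `n`-sheeted cover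
of `Γ`, in which the lift of the edge `e` that ends in sheet `i` starts in sheet `σ e i`. A section
of this cover is given by a function `f` that chooses a sheet over every vertex. For
`η : Γ ⟶ Δ` and a labelling `σ` of the edges of `Δ`, the sections over `Γ` for the labelling
`σ ∘ η.onE` are the lifts of `η` to the cover of `Δ` defined by `σ`. -/
def IsLift (σ : Γ.E → Equiv.Perm (Fin n)) (f : Γ.V → Fin n) : Prop :=
  ∀ e, σ e (f (Γ.tgt e)) = f (Γ.src e)

theorem IsLift.hol_apply {σ : Γ.E → Equiv.Perm (Fin n)} {f : Γ.V → Fin n} (hf : IsLift σ f)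
    {u v : Γ.V} {g : FreeGroup B} (hg : g ∈ Γ.pathLabels u v) : hol σ u g (f v) = f u := by
  refine pathLabels_induction (P := fun u v g => hol σ u g (f v) = f u) (fun v => ?_)
    (fun e v g hg ih => ?_) (fun e v g hg ih => ?_) hg
  · rw [hol_one]
    rfl
  · rw [hol_mul σ (of_lab_mem_pathLabels e) hg, hol_of, Equiv.Perm.mul_apply, ih, hf]
  · rw [hol_mul σ (inv_mem_pathLabels (of_lab_mem_pathLabels e)) hg,
      hol_inv σ (of_lab_mem_pathLabels e), hol_of, Equiv.Perm.mul_apply, ih,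
      Equiv.Perm.inv_eq_iff_eq, hf]

/-- The `G`-component of a holonomy in the wreath product, read off along a lift, is a holonomy
in `G`. -/
theorem IsLift.hol_left {G : Type*} [Group G] {x : Γ.E → Wreath G n} {f : Γ.V → Fin n}
    (hf : IsLift (fun e => (x e).right) f) {u v : Γ.V} {g : FreeGroup B}
    (hg : g ∈ Γ.pathLabels u v) :
    hol (fun e => (x e).left (f (Γ.src e))) u g = (hol x u g).left (f u) := by
  refine hol_eq_of_mul (h := fun u g => (hol x u g).left (f u)) (fun u v w g g' hg hg' => ?_)
    (fun e => ?_) hg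
  · have h1 : (hol x u g).right (f v) = f u := by
      rw [← hf.hol_apply hg]
      exact congrFun (congrArg DFunLike.coe
        (hol_monoidHom (SemidirectProduct.rightHom : Wreath G n →* _) x hg).symm) _
    rw [hol_mul x hg hg', SemidirectProduct.mul_left, Pi.mul_apply]
    change _ * (hol x v g').left ((hol x u g).right⁻¹ (f u)) = _
    rw [Equiv.Perm.inv_eq_iff_eq.2 h1.symm]
  · rw [hol_of]

/-- A lift of `Γ` is determined by its values at one vertex in every component, and these can be
arbitrary fixed points of the holonomy of the fundamental groups. -/
theorem bijective_lift_comp {ι : Type*} {s : ι → Γ.V}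
    (hs : Function.Bijective fun i => Γ.comp (s i)) (σ : Γ.E → Equiv.Perm (Fin n)) :
    Function.Bijective fun f : {f // IsLift σ f} => (fun i => ⟨f.1 (s i), fun _ hg =>
      f.2.hol_apply hg⟩ : ∀ i, {p : Fin n // ∀ g ∈ Γ.pi1 (s i), hol σ (s i) g p = p}) := by
  have hpath : ∀ v, ∃ i t, t ∈ Γ.pathLabels (s i) v := fun v => by
    obtain ⟨i, hi⟩ := hs.2 (Γ.comp v)
    exact ⟨i, comp_eq_iff.1 hi⟩
  choose i t ht using hpath
  constructor
  · intro f f' h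
    refine Subtype.ext (funext fun v => ?_)
    have h1 : f.1 (s (i v)) = f'.1 (s (i v)) := congrArg Subtype.val (congrFun h (i v))
    rw [← f.2.hol_apply (ht v), ← f'.2.hol_apply (ht v)] at h1
    exact (hol σ (s (i v)) (t v)).injective h1
  · intro p
    have hi : ∀ {u v g}, g ∈ Γ.pathLabels u v → i u = i v := fun {u v g} hg =>
      hs.1 (comp_eq_iff.2 ⟨_, mul_mem_pathLabels (mul_mem_pathLabels (ht u) hg)
        (inv_mem_pathLabels (ht v))⟩)
    have key : ∀ {j v a b}, a ∈ Γ.pathLabels (s j) v → b ∈ Γ.pathLabels (s j) v →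
        (hol σ (s j) a)⁻¹ (p j) = (hol σ (s j) b)⁻¹ (p j) := by
      intro j v a b ha hb
      have h1 := (p j).2 _ (mul_mem_pathLabels ha (inv_mem_pathLabels hb))
      rw [hol_mul σ ha (inv_mem_pathLabels hb), hol_inv σ hb, Equiv.Perm.mul_apply] at h1
      rw [Equiv.Perm.inv_eq_iff_eq, h1]
    refine ⟨⟨fun v => (hol σ (s (i v)) (t v))⁻¹ (p (i v)), fun e => ?_⟩,
      funext fun j => Subtype.ext ?_⟩
    · have he := of_lab_mem_pathLabels e
      have hu := mul_mem_pathLabels (ht (Γ.src e)) he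
      have hv := ht (Γ.tgt e)
      simp only
      rw [← hi he] at hv ⊢
      rw [key hv hu, hol_mul σ (ht _) he, hol_of, mul_inv_rev, Equiv.Perm.mul_apply]
      exact (σ e).apply_symm_apply _
    · have hj : i (s j) = j := hs.1 (comp_eq_iff.2 ⟨_, ht (s j)⟩)
      have hv := ht (s j)
      simp only
      rw [hj] at hv ⊢
      rw [key hv (one_mem_pathLabels _), hol_one]
      rfl

/-- A lift of `η` to the cover of its codomain defined by `σ` that is injective, as a map from the
vertices of `Γ` to the vertices of the cover. -/
def IsInjLift (η : Γ ⟶ Δ) (σ : Δ.E → Equiv.Perm (Fin n)) (f : Γ.V → Fin n) : Prop :=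
  IsLift (σ ∘ η.onE) f ∧ Function.Injective fun v => (η.onV v, f v)

/-! ### Factoring a lift through its image -/

/-- The image of a lift of `η : Γ ⟶ Δ` in the cover of `Δ` defined by `σ`. An edge of the cover is
recorded by the sheet of its source. -/
def liftImage (η : Γ ⟶ Δ) (σ : Δ.E → Equiv.Perm (Fin n)) (f : Γ.V → Fin n)
    (hf : IsLift (σ ∘ η.onE) f) : MultiCoreGraph B where
  V := Set.range fun v => (η.onV v, f v)
  E := Set.range fun e => (η.onE e, f (Γ.src e))
  finV := inferInstance
  finE := inferInstance
  src e := ⟨(Δ.src e.1.1, e.1.2), by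
    obtain ⟨_, e, rfl⟩ := e
    exact ⟨Γ.src e, by rw [η.src_comm]⟩⟩
  tgt e := ⟨(Δ.tgt e.1.1, (σ e.1.1)⁻¹ e.1.2), by
    obtain ⟨_, e, rfl⟩ := e
    refine ⟨Γ.tgt e, Prod.ext (η.tgt_comm e).symm ?_⟩
    exact Equiv.Perm.eq_inv_iff_eq.2 (hf e)⟩
  lab e := Δ.lab e.1.1
  src_inj := by
    rintro ⟨⟨e, i⟩, he⟩ ⟨⟨e', i'⟩, he'⟩ h hl
    have h' := congrArg Subtype.val h
    simp only [Prod.mk.injEq] at h'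
    obtain rfl := Δ.src_inj _ _ h'.1 hl
    exact Subtype.ext (Prod.ext rfl h'.2)
  tgt_inj := by
    rintro ⟨⟨e, i⟩, he⟩ ⟨⟨e', i'⟩, he'⟩ h hl
    have h' := congrArg Subtype.val h
    simp only [Prod.mk.injEq] at h'
    obtain rfl := Δ.tgt_inj _ _ h'.1 hl
    exact Subtype.ext (Prod.ext rfl ((σ e)⁻¹.injective h'.2))
  two_le_degree := by
    have hlab : ∀ {e e' : Γ.E}, η.onE e = η.onE e' → Γ.lab e = Γ.lab e' := fun {e e'} h => by
      rw [← η.lab_comm, h, η.lab_comm]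
    rintro ⟨_, v, rfl⟩
    refine (Γ.two_le_degree v).trans (add_le_add
      (Nat.card_le_card_of_injective
        (fun e => ⟨⟨_, e.1, rfl⟩, Subtype.ext ?_⟩) fun e e' h => ?_)
      (Nat.card_le_card_of_injective
        (fun e => ⟨⟨_, e.1, rfl⟩, Subtype.ext ?_⟩) fun e e' h => ?_))
    · exact Prod.ext (by simp only [η.src_comm, e.2]) (by simp only [e.2])
    · have h1 := congrArg (fun z => z.1.1.1) h
      exact Subtype.ext (Γ.src_inj _ _ (e.2.trans e'.2.symm) (hlab h1))
    · refine Prod.ext (by simp only [η.tgt_comm, e.2]) ?_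
      simp only [← e.2]
      exact Equiv.Perm.inv_eq_iff_eq.2 (hf e).symm
    · have h1 := congrArg (fun z => z.1.1.1) h
      exact Subtype.ext (Γ.tgt_inj _ _ (e.2.trans e'.2.symm) (hlab h1))

/-- The factorization of `η` through the image of a lift. -/
def liftDecomp (η : Γ ⟶ Δ) (hη : Surj η) (σ : Δ.E → Equiv.Perm (Fin n)) (f : Γ.V → Fin n)
    (hf : IsLift (σ ∘ η.onE) f) : PreDecomp η where
  mid := liftImage η σ f hf
  fst := ⟨fun v => ⟨_, v, rfl⟩, fun e => ⟨_, e, rfl⟩,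
    fun e => Subtype.ext (Prod.ext (η.src_comm e) rfl),
    fun e => Subtype.ext (Prod.ext (η.tgt_comm e) (Equiv.Perm.inv_eq_iff_eq.2 (hf e).symm)),
    fun e => η.lab_comm e⟩
  snd := ⟨fun v => v.1.1, fun e => e.1.1, fun _ => rfl, fun _ => rfl, fun _ => rfl⟩
  fst_surj := ⟨fun ⟨_, v, hv⟩ => ⟨v, Subtype.ext hv⟩, fun ⟨_, e, he⟩ => ⟨e, Subtype.ext he⟩⟩
  snd_surj := ⟨fun v => by
      obtain ⟨u, rfl⟩ := hη.1 v
      exact ⟨⟨_, u, rfl⟩, rfl⟩,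
    fun e => by
      obtain ⟨a, rfl⟩ := hη.2 e
      exact ⟨⟨_, a, rfl⟩, rfl⟩⟩
  fac := rfl

theorem Surj.cancel {f : Γ ⟶ Δ} (hf : Surj f) {g h : Δ ⟶ Λ} (e : f ≫ g = f ≫ h) : g = h := by
  refine hom_ext' (funext fun x => ?_) (funext fun x => ?_)
  · obtain ⟨x, rfl⟩ := hf.1 x
    exact congrFun (congrArg Hom.onV e) x
  · obtain ⟨x, rfl⟩ := hf.2 x
    exact congrFun (congrArg Hom.onE e) x

/-- A morphism factors through a surjective one if it identifies whatever the latter does. -/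
theorem Surj.exists_factor {f : Γ ⟶ Δ} (hf : Surj f) (g : Γ ⟶ Λ)
    (hV : ∀ x y, f.onV x = f.onV y → g.onV x = g.onV y)
    (hE : ∀ x y, f.onE x = f.onE y → g.onE x = g.onE y) : ∃ h : Δ ⟶ Λ, f ≫ h = g := by
  have fV : ∀ x, g.onV (Function.surjInv hf.1 (f.onV x)) = g.onV x :=
    fun x => hV _ _ (Function.surjInv_eq hf.1 _)
  have fE : ∀ x, g.onE (Function.surjInv hf.2 (f.onE x)) = g.onE x :=
    fun x => hE _ _ (Function.surjInv_eq hf.2 _)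
  refine ⟨⟨fun x => g.onV (Function.surjInv hf.1 x), fun x => g.onE (Function.surjInv hf.2 x),
    fun e => ?_, fun e => ?_, fun e => ?_⟩, hom_ext' (funext fV) (funext fE)⟩
  · obtain ⟨e, rfl⟩ := hf.2 e
    rw [fE, f.src_comm, fV, g.src_comm]
  · obtain ⟨e, rfl⟩ := hf.2 e
    rw [fE, f.tgt_comm, fV, g.tgt_comm]
  · obtain ⟨e, rfl⟩ := hf.2 e
    rw [fE, f.lab_comm, g.lab_comm]

theorem preDecomp_equiv_of_ker {η : Γ ⟶ Δ} (a b : PreDecomp η)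
    (hV : ∀ x y, a.fst.onV x = a.fst.onV y ↔ b.fst.onV x = b.fst.onV y)
    (hE : ∀ x y, a.fst.onE x = a.fst.onE y ↔ b.fst.onE x = b.fst.onE y) : a ≈ b := by
  obtain ⟨f, hf⟩ := a.fst_surj.exists_factor b.fst (fun x y => (hV x y).1) fun x y => (hE x y).1
  obtain ⟨g, hg⟩ := b.fst_surj.exists_factor a.fst (fun x y => (hV x y).2) fun x y => (hE x y).2
  refine ⟨⟨f, g, ?_, ?_⟩, hf, ?_⟩
  · exact a.fst_surj.cancel (by rw [reassoc_of% hf, hg, CategoryTheory.Category.comp_id])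
  · exact b.fst_surj.cancel (by rw [reassoc_of% hg, hf, CategoryTheory.Category.comp_id])
  · exact a.fst_surj.cancel (by rw [reassoc_of% hf, b.fac, a.fac])

theorem IsLift.comp {η : Γ ⟶ Δ} {σ : Δ.E → Equiv.Perm (Fin n)} {f : Δ.V → Fin n}
    (hf : IsLift σ f) : IsLift (σ ∘ η.onE) (f ∘ η.onV) := fun e => by
  have := hf (η.onE e)
  rwa [η.src_comm, η.tgt_comm] at this

theorem IsInjLift.ker_iff {η : Γ ⟶ Δ} {σ : Δ.E → Equiv.Perm (Fin n)} {a : PreDecomp η}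
    {g : a.mid.V → Fin n} (hg : IsInjLift a.snd σ g) :
    (∀ x y, a.fst.onV x = a.fst.onV y ↔
      η.onV x = η.onV y ∧ g (a.fst.onV x) = g (a.fst.onV y)) ∧
    (∀ x y, a.fst.onE x = a.fst.onE y ↔ η.onE x = η.onE y ∧
      g (a.fst.onV (Γ.src x)) = g (a.fst.onV (Γ.src y))) := by
  have hV : ∀ x, η.onV x = a.snd.onV (a.fst.onV x) :=
    fun x => (congrFun (congrArg Hom.onV a.fac) x).symm
  have hE : ∀ x, η.onE x = a.snd.onE (a.fst.onE x) :=
    fun x => (congrFun (congrArg Hom.onE a.fac) x).symm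
  refine ⟨fun x y => ⟨fun h => by rw [hV, hV, h]; exact ⟨rfl, rfl⟩, fun ⟨h, h'⟩ => ?_⟩,
    fun x y => ⟨fun h => ?_, fun ⟨h, h'⟩ => ?_⟩⟩
  · rw [hV, hV] at h
    exact hg.2 (Prod.ext h h')
  · rw [hE, hE, ← a.fst.src_comm, ← a.fst.src_comm, h]
    exact ⟨rfl, rfl⟩
  · have h1 : η.onV (Γ.src x) = η.onV (Γ.src y) := by
      rw [← η.src_comm, h, η.src_comm]
    rw [hV, hV] at h1
    refine a.mid.src_inj _ _ ?_ ?_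
    · rw [a.fst.src_comm, a.fst.src_comm]
      exact hg.2 (Prod.ext h1 h')
    · rw [a.fst.lab_comm, a.fst.lab_comm, ← η.lab_comm, h, η.lab_comm]

/-- Every lift of `η` factors uniquely as the first map of a decomposition of `η`, followed by
an injective lift of the second map. -/
theorem bijective_injLift_comp {η : Γ ⟶ Δ} (hη : Surj η) (σ : Δ.E → Equiv.Perm (Fin n)) :
    Function.Bijective fun p : Σ d : Decomp η, {g // IsInjLift (Quotient.out d).snd σ g} =>
      (⟨p.2.1 ∘ (Quotient.out p.1).fst.onV, by
        have h := p.2.2.1.comp (η := (Quotient.out p.1).fst)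
        rwa [Function.comp_assoc, ← comp_onE, (Quotient.out p.1).fac] at h⟩ :
        {f // IsLift (σ ∘ η.onE) f}) := by
  constructor
  · rintro ⟨d, g, hg⟩ ⟨d', g', hg'⟩ h
    have h1 : ∀ v, g ((Quotient.out d).fst.onV v) = g' ((Quotient.out d').fst.onV v) :=
      congrFun (congrArg Subtype.val h)
    obtain rfl : d = d' := by
      rw [← Quotient.out_eq d, ← Quotient.out_eq d']
      refine Quotient.sound (preDecomp_equiv_of_ker _ _ (fun x y => ?_) fun x y => ?_)
      · rw [hg.ker_iff.1, hg'.ker_iff.1, h1, h1]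
      · rw [hg.ker_iff.2, hg'.ker_iff.2, h1, h1]
    obtain rfl : g = g' := funext fun v => by
      obtain ⟨v, rfl⟩ := (Quotient.out d).fst_surj.1 v
      exact h1 v
    rfl
  · rintro ⟨f, hf⟩
    let a := liftDecomp η hη σ f hf
    let d : Decomp η := Quotient.mk _ a
    obtain ⟨θ, h1, h2⟩ : Quotient.out d ≈ a := Quotient.exact (Quotient.out_eq d)
    have hV : ∀ v, (Quotient.out d).snd.onV v = (θ.hom.onV v).1.1 := fun v =>
      (congrFun (congrArg Hom.onV h2) v).symm
    refine ⟨⟨d, fun v => (θ.hom.onV v).1.2, fun e => ?_, fun v v' h => ?_⟩,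
      Subtype.ext (funext fun v => ?_)⟩
    · have hE : (Quotient.out d).snd.onE e = (θ.hom.onE e).1.1 :=
        (congrFun (congrArg Hom.onE h2) e).symm
      simp only [Function.comp_apply, hE]
      rw [← θ.hom.tgt_comm, ← θ.hom.src_comm]
      exact (σ (θ.hom.onE e).1.1).apply_symm_apply _
    · obtain ⟨h3, h4⟩ := Prod.mk.inj h
      rw [hV, hV] at h3
      have h4 : θ.hom.onV v = θ.hom.onV v' := Subtype.ext (Prod.ext h3 h4)
      rw [← iso_onV_inv_hom θ v, h4, iso_onV_inv_hom]
    · exact congrArg (fun z => z.1.2) (congrFun (congrArg Hom.onV h1) v)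

end Lifts

/-! ### The expected number of injective lifts -/

section InjLifts

variable {B : Type*} {Γ Δ : MultiCoreGraph B}

/-- The expected number of injective lifts of `η : Γ ⟶ Δ` to a uniformly random `n`-sheeted cover
of `Δ`. -/
def injExpect (n : ℕ) (η : Γ ⟶ Δ) : ℂ :=
  avg fun σ : Δ.E → Equiv.Perm (Fin n) => (Nat.card {f // IsInjLift η σ f} : ℂ)

theorem hom_comp_onE_inv (ψ : Γ ≅ Δ) (e : Δ.E) : ψ.hom.onE (ψ.inv.onE e) = e :=
  congrFun (congrArg Hom.onE ψ.inv_hom_id) e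

theorem inv_comp_onE_hom (ψ : Γ ≅ Δ) (e : Γ.E) : ψ.inv.onE (ψ.hom.onE e) = e :=
  congrFun (congrArg Hom.onE ψ.hom_inv_id) e

/-- The bijection of edges induced by an isomorphism. -/
def edgeEquiv (ψ : Γ ≅ Δ) : Γ.E ≃ Δ.E :=
  ⟨ψ.hom.onE, ψ.inv.onE, inv_comp_onE_hom ψ, hom_comp_onE_inv ψ⟩

/-- The bijection of vertices induced by an isomorphism. -/
def vertexEquiv (ψ : Γ ≅ Δ) : Γ.V ≃ Δ.V :=
  ⟨ψ.hom.onV, ψ.inv.onV, iso_onV_inv_hom ψ, iso_onV_hom_inv ψ⟩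

theorem IsInjLift.congr {n : ℕ} {Γ' Δ' : MultiCoreGraph B} {η : Γ ⟶ Δ} {η' : Γ' ⟶ Δ'}
    {φ : Γ ⟶ Γ'} {ψ : Δ ⟶ Δ'} (hφ : Function.Injective φ.onV) (h : φ ≫ η' = η ≫ ψ)
    {σ : Δ'.E → Equiv.Perm (Fin n)} {f : Γ'.V → Fin n} (hf : IsInjLift η' σ f) :
    IsInjLift η (σ ∘ ψ.onE) (f ∘ φ.onV) := by
  constructor
  · have h1 := hf.1.comp (η := φ)
    rwa [Function.comp_assoc, ← comp_onE, h, comp_onE, ← Function.comp_assoc] at h1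
  · intro v v' hv
    obtain ⟨h1, h2⟩ := Prod.mk.inj hv
    refine hφ (hf.2 (Prod.ext ?_ h2))
    have h3 : ∀ u, η'.onV (φ.onV u) = ψ.onV (η.onV u) := congrFun (congrArg Hom.onV h)
    simp only [h3, h1]

theorem injExpect_congr {Γ' Δ' : MultiCoreGraph B} (n : ℕ) (η : Γ ⟶ Δ) (η' : Γ' ⟶ Δ')
    (φ : Γ ≅ Γ') (ψ : Δ ≅ Δ') (h : φ.hom ≫ η' = η ≫ ψ.hom) :
    injExpect n η = injExpect n η' := by
  have h' : φ.inv ≫ η = η' ≫ ψ.inv := by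
    rw [CategoryTheory.Iso.inv_comp_eq, ← CategoryTheory.Category.assoc, h]
    simp
  refine (avg_equiv ((edgeEquiv ψ).symm.arrowCongr (Equiv.refl _)) _ _ fun σ => ?_).symm
  refine congrArg Nat.cast (Nat.card_congr
    (Equiv.subtypeEquiv ((vertexEquiv φ).symm.arrowCongr (Equiv.refl _)) fun f => ?_))
  refine ⟨fun hf => hf.congr (vertexEquiv φ).injective h, fun hf => ?_⟩
  have h2 := IsInjLift.congr (vertexEquiv φ).symm.injective h' hf
  convert h2 using 1
  · funext e
    exact congrArg σ (hom_comp_onE_inv ψ e).symm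
  · funext v
    exact congrArg f (iso_onV_hom_inv φ v).symm

/-- The expected number of injective lifts, as a function on `sur_B`. -/
def injE (B : Type*) (n : ℕ) : SurB B → ℂ :=
  Quotient.lift (fun a : SurArrow B => injExpect n a.hom) fun _ _ ⟨φ, ψ, h⟩ =>
    injExpect_congr n _ _ φ ψ h

theorem Decomp.snd_eq {η : Γ ⟶ Δ} (d : Decomp η) :
    d.snd = SurB.mk (Quotient.out d).snd (Quotient.out d).snd_surj :=
  congrArg Decomp.snd (Quotient.out_eq d).symm

theorem Decomp.fst_eq {η : Γ ⟶ Δ} (d : Decomp η) :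
    d.fst = SurB.mk (Quotient.out d).fst (Quotient.out d).fst_surj :=
  congrArg Decomp.fst (Quotient.out_eq d).symm

theorem Decomp.fstQ_eq {η : Γ ⟶ Δ} (d : Decomp η) :
    d.fstQ = QB.mk (Quotient.out d).fst (Quotient.out d).fst_surj :=
  congrArg Decomp.fstQ (Quotient.out_eq d).symm

theorem injE_snd (n : ℕ) {η : Γ ⟶ Δ} (d : Decomp η) :
    injE B n d.snd = injExpect n (Quotient.out d).snd := by
  rw [Decomp.snd_eq]
  rfl

/-- A family of common fixed points, one for each component of `Γ`, is a lift of `η`, so that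
`E_η[S_n ↷ [n]]` is the expected number of lifts of `η` to a random cover. -/
theorem permExpect_eq_avg (n : ℕ) (η : Γ ⟶ Δ) :
    permExpect n η = avg fun σ : Δ.E → Equiv.Perm (Fin n) =>
      (Nat.card {f // IsLift (σ ∘ η.onE) f} : ℂ) := by
  have := Fintype.ofFinite Γ.Comp
  rw [permExpect, homExpect_eq_avg]
  · congr 1
    funext σ
    have hs : Function.Bijective fun c => Γ.comp (Γ.base c) := by
      simp only [comp_base]
      exact Function.bijective_id
    rw [Nat.card_congr (Equiv.ofBijective _ (bijective_lift_comp hs _)), Nat.card_pi, Nat.cast_prod]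
    refine Finset.prod_congr rfl fun c _ => congrArg Nat.cast (Nat.card_congr
      (Equiv.subtypeEquivRight fun x => ?_))
    rw [Subtype.forall]
    refine forall₂_congr fun g hg => ?_
    rw [hol_comp_onE η σ hg]
    rfl
  · intro c k α
    refine congrArg Nat.cast (Nat.card_congr (Equiv.subtypeEquiv k⁻¹ fun x => ?_))
    refine forall_congr' fun y => ?_
    change k (α _ (k⁻¹ x)) = x ↔ _
    rw [Equiv.Perm.eq_inv_iff_eq]

theorem permE_eq_conv (B : Type*) (n : ℕ) : permE B n = conv 1 (injE B n) := by
  funext c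
  induction c using Quotient.inductionOn with
  | h a =>
    have := Fintype.ofFinite (Decomp a.hom)
    change permExpect n a.hom = ∑ᶠ d : Decomp a.hom, 1 * injE B n d.snd
    rw [permExpect_eq_avg, finsum_eq_sum_of_fintype]
    simp only [one_mul, injE_snd, injExpect]
    rw [← avg_sum]
    congr 1
    funext σ
    rw [← Nat.card_congr (Equiv.ofBijective _ (bijective_injLift_comp a.surj σ)), Nat.card_sigma,
      Nat.cast_sum]

end InjLifts

/-! ### The convolution algebra -/

section Convolution

open CategoryTheory

variable {B : Type*} {Γ Δ : MultiCoreGraph B}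

/-- A factorization `Γ ↠ mid₁ ↠ mid₂ ↠ Δ` of a morphism into three `B`-surjective morphisms. -/
structure PreTriple (η : Γ ⟶ Δ) where
  mid₁ : MultiCoreGraph B
  mid₂ : MultiCoreGraph B
  fst : Γ ⟶ mid₁
  snd : mid₁ ⟶ mid₂
  trd : mid₂ ⟶ Δ
  fst_surj : Surj fst
  snd_surj : Surj snd
  trd_surj : Surj trd
  fac : fst ≫ snd ≫ trd = η

instance PreTriple.setoid (η : Γ ⟶ Δ) : Setoid (PreTriple η) where
  r a b := ∃ (θ₁ : a.mid₁ ≅ b.mid₁) (θ₂ : a.mid₂ ≅ b.mid₂),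
    a.fst ≫ θ₁.hom = b.fst ∧ θ₁.hom ≫ b.snd = a.snd ≫ θ₂.hom ∧ θ₂.hom ≫ b.trd = a.trd
  iseqv := by
    refine ⟨fun a => ⟨Iso.refl _, Iso.refl _, by simp, by simp, by simp⟩, ?_, ?_⟩
    · rintro a b ⟨θ₁, θ₂, h, h', h''⟩
      exact ⟨θ₁.symm, θ₂.symm, by simp [← h], by simp [Iso.inv_comp_eq, reassoc_of% h'],
        by simp [← h'']⟩
    · rintro a b c ⟨θ₁, θ₂, h, h', h''⟩ ⟨κ₁, κ₂, k, k', k''⟩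
      exact ⟨θ₁ ≪≫ κ₁, θ₂ ≪≫ κ₂, by simp [← k, ← h], by simp [k', reassoc_of% h'],
        by simp [k'', h'']⟩

/-- The factorizations of `η` into three `B`-surjective morphisms, up to isomorphism of the middle
objects. -/
def Triple (η : Γ ⟶ Δ) := Quotient (PreTriple.setoid η)

namespace Triple

variable {η : Γ ⟶ Δ}

/-- The first morphism of a triple, as an element of `Q_B(Γ)`. -/
def fstQ : Triple η → QB Γ :=
  Quotient.lift (fun a => QB.mk a.fst a.fst_surj) fun _ _ ⟨θ₁, _, h, _, _⟩ =>
    Quotient.sound ⟨θ₁, h⟩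

/-- The first morphism of a triple, as an element of `sur_B`. -/
def fst : Triple η → SurB B :=
  Quotient.lift (fun a => SurB.mk a.fst a.fst_surj) fun a b ⟨θ₁, _, h, _, _⟩ =>
    Quotient.sound (s := SurArrow.setoid B) ⟨Iso.refl _, θ₁, by
      change 𝟙 Γ ≫ b.fst = a.fst ≫ θ₁.hom
      simp [h]⟩

/-- The second morphism of a triple, as an element of `sur_B`. -/
def snd : Triple η → SurB B :=
  Quotient.lift (fun a => SurB.mk a.snd a.snd_surj) fun _ _ ⟨θ₁, θ₂, _, h, _⟩ =>
    Quotient.sound (s := SurArrow.setoid B) ⟨θ₁, θ₂, h⟩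

/-- The third morphism of a triple, as an element of `sur_B`. -/
def trd : Triple η → SurB B :=
  Quotient.lift (fun a => SurB.mk a.trd a.trd_surj) fun a b ⟨_, θ₂, _, _, h⟩ =>
    Quotient.sound (s := SurArrow.setoid B) ⟨θ₂, Iso.refl _, by
      change θ₂.hom ≫ b.trd = a.trd ≫ 𝟙 Δ
      simp [h]⟩

/-- Refine a decomposition by decomposing its first morphism. -/
def ofFst (a : PreDecomp η) : Decomp a.fst → Triple η :=
  Quotient.map
    (fun x => ⟨x.mid, a.mid, x.fst, x.snd, a.snd, x.fst_surj, x.snd_surj, a.snd_surj, by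
      rw [reassoc_of% x.fac, a.fac]⟩)
    fun _ _ ⟨θ, h, h'⟩ => ⟨θ, Iso.refl _, h, by simp [h'], by simp⟩

/-- Refine a decomposition by decomposing its second morphism. -/
def ofSnd (a : PreDecomp η) : Decomp a.snd → Triple η :=
  Quotient.map
    (fun x => ⟨a.mid, x.mid, a.fst, x.fst, x.snd, a.fst_surj, x.fst_surj, x.snd_surj, by
      rw [x.fac, a.fac]⟩)
    fun _ _ ⟨θ, h, h'⟩ => ⟨Iso.refl _, θ, by simp, by simp [h], h'⟩

/-- Every triple arises uniquely from the decomposition that composes its first two morphisms;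
uniqueness holds because surjective morphisms are epimorphisms. -/
theorem bijective_ofFst (η : Γ ⟶ Δ) :
    Function.Bijective fun p : Σ d : Decomp η, Decomp (Quotient.out d).fst =>
      ofFst (Quotient.out p.1) p.2 := by
  constructor
  · rintro ⟨d, x⟩ ⟨d', x'⟩ h
    induction x using Quotient.inductionOn with | h x =>
    induction x' using Quotient.inductionOn with | h x' =>
    obtain ⟨θ₁, θ₂, h1, h2, h3⟩ := Quotient.exact h
    change x.fst ≫ θ₁.hom = x'.fst at h1
    change θ₁.hom ≫ x'.snd = x.snd ≫ θ₂.hom at h2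
    change θ₂.hom ≫ (Quotient.out d').snd = (Quotient.out d).snd at h3
    have h4 : (Quotient.out d).fst ≫ θ₂.hom = (Quotient.out d').fst := by
      refine (congrArg (· ≫ θ₂.hom) x.fac).symm.trans (Eq.trans ?_ x'.fac)
      rw [Category.assoc, ← h2, reassoc_of% h1]
    obtain rfl : d = d' := by
      rw [← Quotient.out_eq d, ← Quotient.out_eq d']
      exact Quotient.sound ⟨θ₂, h4, h3⟩
    have h5 : θ₂.hom = 𝟙 _ :=
      (Quotient.out d).fst_surj.cancel (h4.trans (Category.comp_id _).symm)
    refine congrArg (Sigma.mk d) (Quotient.sound ⟨θ₁, h1, ?_⟩)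
    rw [h2, h5, Category.comp_id]
  · intro t
    induction t using Quotient.inductionOn with | h t =>
    let a : PreDecomp η := ⟨t.mid₂, t.fst ≫ t.snd, t.trd, t.fst_surj.comp t.snd_surj, t.trd_surj,
      by rw [Category.assoc, t.fac]⟩
    let d : Decomp η := Quotient.mk _ a
    obtain ⟨θ, h1, h2⟩ : a ≈ Quotient.out d := Quotient.exact (Quotient.out_eq d).symm
    let x : PreDecomp (Quotient.out d).fst := ⟨t.mid₁, t.fst, t.snd ≫ θ.hom, t.fst_surj,
      t.snd_surj.comp (surj_iso θ), by rw [← h1, Category.assoc]⟩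
    refine ⟨⟨d, Quotient.mk _ x⟩, Quotient.sound ⟨Iso.refl _, θ.symm, ?_, ?_, ?_⟩⟩
    · exact Category.comp_id _
    · change 𝟙 _ ≫ t.snd = (t.snd ≫ θ.hom) ≫ θ.inv
      simp
    · change θ.inv ≫ t.trd = (Quotient.out d).snd
      rw [Iso.inv_comp_eq, h2]

/-- Every triple arises uniquely from the decomposition that composes its last two morphisms. -/
theorem bijective_ofSnd (η : Γ ⟶ Δ) :
    Function.Bijective fun p : Σ d : Decomp η, Decomp (Quotient.out d).snd =>
      ofSnd (Quotient.out p.1) p.2 := by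
  constructor
  · rintro ⟨d, x⟩ ⟨d', x'⟩ h
    induction x using Quotient.inductionOn with | h x =>
    induction x' using Quotient.inductionOn with | h x' =>
    obtain ⟨θ₁, θ₂, h1, h2, h3⟩ := Quotient.exact h
    change (Quotient.out d).fst ≫ θ₁.hom = (Quotient.out d').fst at h1
    change θ₁.hom ≫ x'.fst = x.fst ≫ θ₂.hom at h2
    change θ₂.hom ≫ x'.snd = x.snd at h3
    have h4 : θ₁.hom ≫ (Quotient.out d').snd = (Quotient.out d).snd := by
      refine (congrArg (θ₁.hom ≫ ·) x'.fac).symm.trans (Eq.trans ?_ x.fac)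
      rw [reassoc_of% h2, h3]
    obtain rfl : d = d' := by
      rw [← Quotient.out_eq d, ← Quotient.out_eq d']
      exact Quotient.sound ⟨θ₁, h1, h4⟩
    have h5 : θ₁.hom = 𝟙 _ :=
      (Quotient.out d).fst_surj.cancel (h1.trans (Category.comp_id _).symm)
    refine congrArg (Sigma.mk d) (Quotient.sound ⟨θ₂, ?_, h3⟩)
    rw [← h2, h5, Category.id_comp]
  · intro t
    induction t using Quotient.inductionOn with | h t =>
    let a : PreDecomp η := ⟨t.mid₁, t.fst, t.snd ≫ t.trd, t.fst_surj, t.snd_surj.comp t.trd_surj,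
      t.fac⟩
    let d : Decomp η := Quotient.mk _ a
    obtain ⟨θ, h1, h2⟩ : Quotient.out d ≈ a := Quotient.exact (Quotient.out_eq d)
    let x : PreDecomp (Quotient.out d).snd := ⟨t.mid₂, θ.hom ≫ t.snd, t.trd,
      (surj_iso θ).comp t.snd_surj, t.trd_surj, by rw [← h2, Category.assoc]⟩
    refine ⟨⟨d, Quotient.mk _ x⟩, Quotient.sound ⟨θ, Iso.refl _, h1, ?_, ?_⟩⟩
    · exact (Category.comp_id _).symm
    · exact Category.id_comp _

theorem ofFst_proj (d : Decomp η) (x : Decomp (Quotient.out d).fst) :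
    (ofFst (Quotient.out d) x).fstQ = x.fstQ ∧ (ofFst (Quotient.out d) x).fst = x.fst ∧
      (ofFst (Quotient.out d) x).snd = x.snd ∧ (ofFst (Quotient.out d) x).trd = d.snd := by
  rw [d.snd_eq]
  induction x using Quotient.inductionOn with
  | h x => exact ⟨rfl, rfl, rfl, rfl⟩

theorem ofSnd_proj (d : Decomp η) (x : Decomp (Quotient.out d).snd) :
    (ofSnd (Quotient.out d) x).fstQ = d.fstQ ∧ (ofSnd (Quotient.out d) x).fst = d.fst ∧
      (ofSnd (Quotient.out d) x).snd = x.fst ∧ (ofSnd (Quotient.out d) x).trd = x.snd := by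
  rw [d.fst_eq, d.fstQ_eq]
  induction x using Quotient.inductionOn with
  | h x => exact ⟨rfl, rfl, rfl, rfl⟩

theorem finsum_ofFst_eq_finsum_ofSnd (η : Γ ⟶ Δ) (F : Triple η → ℂ) :
    ∑ᶠ d : Decomp η, ∑ᶠ x, F (ofFst (Quotient.out d) x) =
      ∑ᶠ d : Decomp η, ∑ᶠ x, F (ofSnd (Quotient.out d) x) := by
  have : ∀ {Λ Λ' : MultiCoreGraph B} (θ : Λ ⟶ Λ'), Fintype (Decomp θ) :=
    fun _ => Fintype.ofFinite _
  simp only [finsum_eq_sum_of_fintype]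
  let e := (Equiv.ofBijective _ (bijective_ofFst η)).trans
    (Equiv.ofBijective _ (bijective_ofSnd η)).symm
  refine (Fintype.sum_sigma fun p : Σ d : Decomp η, Decomp (Quotient.out d).fst =>
    F (ofFst (Quotient.out p.1) p.2)).symm.trans (Eq.trans ?_ (Fintype.sum_sigma
      fun p : Σ d : Decomp η, Decomp (Quotient.out d).snd => F (ofSnd (Quotient.out p.1) p.2)))
  refine Fintype.sum_equiv e _ _ fun p => congrArg F ?_
  exact ((Equiv.ofBijective _ (bijective_ofSnd η)).apply_symm_apply _).symm

end Triple

theorem conv_mk (f g : SurB B → ℂ) (η : Γ ⟶ Δ) (hη : Surj η) :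
    conv f g (SurB.mk η hη) = ∑ᶠ d : Decomp η, f d.fst * g d.snd := rfl

theorem convQ_mk (f : QB Γ → ℂ) (g : SurB B → ℂ) (η : Γ ⟶ Δ) (hη : Surj η) :
    convQ f g (QB.mk η hη) = ∑ᶠ d : Decomp η, f d.fstQ * g d.snd := rfl

theorem conv_assoc (f g h : SurB B → ℂ) : conv (conv f g) h = conv f (conv g h) := by
  funext c
  induction c using Quotient.inductionOn with | h a =>
  have key := Triple.finsum_ofFst_eq_finsum_ofSnd a.hom fun t => f t.fst * g t.snd * h t.trd
  refine Eq.trans (finsum_congr fun d => ?_) (key.trans (finsum_congr fun d => ?_))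
  · rw [d.fst_eq, conv_mk, finsum_mul]
    refine finsum_congr fun x => ?_
    obtain ⟨-, h1, h2, h3⟩ := Triple.ofFst_proj d x
    rw [h1, h2, h3]
  · conv_rhs => rw [d.snd_eq, conv_mk, mul_finsum]
    refine finsum_congr fun x => ?_
    obtain ⟨-, h1, h2, h3⟩ := Triple.ofSnd_proj d x
    rw [h1, h2, h3, mul_assoc]

theorem convQ_assoc (f : QB Γ → ℂ) (g h : SurB B → ℂ) :
    convQ (convQ f g) h = convQ f (conv g h) := by
  funext c
  induction c using Quotient.inductionOn with | h a =>
  have key := Triple.finsum_ofFst_eq_finsum_ofSnd a.hom fun t => f t.fstQ * g t.snd * h t.trd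
  refine Eq.trans (finsum_congr fun d => ?_) (key.trans (finsum_congr fun d => ?_))
  · rw [d.fstQ_eq, convQ_mk, finsum_mul]
    refine finsum_congr fun x => ?_
    obtain ⟨h1, -, h2, h3⟩ := Triple.ofFst_proj d x
    rw [h1, h2, h3]
  · conv_rhs => rw [d.snd_eq, conv_mk, mul_finsum]
    refine finsum_congr fun x => ?_
    obtain ⟨h1, -, h2, h3⟩ := Triple.ofSnd_proj d x
    rw [h1, h2, h3, mul_assoc]

theorem delta_mk_of_isIso (η : Γ ⟶ Δ) (hη : Surj η) (h : IsIso η) :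
    delta (SurB.mk η hη) = 1 :=
  if_pos ⟨⟨Γ, Δ, η, hη⟩, rfl, h⟩

theorem delta_mk_of_not_isIso (η : Γ ⟶ Δ) (hη : Surj η) (h : ¬ IsIso η) :
    delta (SurB.mk η hη) = 0 := by
  refine if_neg ?_
  rintro ⟨a, ha, ha'⟩
  obtain ⟨φ, ψ, e⟩ := Quotient.exact ha
  change φ.hom ≫ η = a.hom ≫ ψ.hom at e
  rw [← Iso.eq_inv_comp] at e
  exact h (e ▸ inferInstance)

theorem delta_conv (f : SurB B → ℂ) : conv delta f = f := by
  funext c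
  induction c using Quotient.inductionOn with | h a =>
  let d₀ : Decomp a.hom := Quotient.mk _ ⟨_, 𝟙 _, a.hom, surj_id _, a.surj, Category.id_comp _⟩
  refine (finsum_eq_single _ d₀ fun d hd => ?_).trans ?_
  · rw [d.fst_eq, delta_mk_of_not_isIso, zero_mul]
    intro h
    refine hd ((Quotient.out_eq d).symm.trans (Quotient.sound ?_))
    refine ⟨(asIso (Quotient.out d).fst).symm, by simp, ?_⟩
    change inv (Quotient.out d).fst ≫ a.hom = _
    rw [IsIso.inv_comp_eq, (Quotient.out d).fac]
  · change delta (SurB.mk (𝟙 a.dom) _) * f (Quotient.mk _ a) = _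
    rw [delta_mk_of_isIso _ _ inferInstance, one_mul]

theorem conv_delta (f : SurB B → ℂ) : conv f delta = f := by
  funext c
  induction c using Quotient.inductionOn with | h a =>
  let d₀ : Decomp a.hom := Quotient.mk _ ⟨_, a.hom, 𝟙 _, a.surj, surj_id _, Category.comp_id _⟩
  refine (finsum_eq_single _ d₀ fun d hd => ?_).trans ?_
  · rw [d.snd_eq, delta_mk_of_not_isIso, mul_zero]
    intro h
    refine hd ((Quotient.out_eq d).symm.trans (Quotient.sound ?_))
    exact ⟨asIso (Quotient.out d).snd, (Quotient.out d).fac, Category.comp_id _⟩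
  · change f (Quotient.mk _ a) * delta (SurB.mk (𝟙 a.cod) _) = _
    rw [delta_mk_of_isIso _ _ inferInstance, mul_one]

theorem add_conv (f g h : SurB B → ℂ) : conv (f + g) h = conv f h + conv g h := by
  funext c
  induction c using Quotient.inductionOn with | h a =>
  refine (finsum_congr fun d => add_mul _ _ _).trans ?_
  exact finsum_add_distrib (Set.toFinite _) (Set.toFinite _)

theorem conv_add (f g h : SurB B → ℂ) : conv f (g + h) = conv f g + conv f h := by
  funext c
  induction c using Quotient.inductionOn with | h a =>
  refine (finsum_congr fun d => mul_add _ _ _).trans ?_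
  exact finsum_add_distrib (Set.toFinite _) (Set.toFinite _)

theorem zero_conv (f : SurB B → ℂ) : conv 0 f = 0 := by
  have := add_conv 0 0 f
  rwa [add_zero, left_eq_add] at this

theorem conv_zero (f : SurB B → ℂ) : conv f 0 = 0 := by
  have := conv_add f 0 0
  rwa [add_zero, left_eq_add] at this

/-- The functions on `sur_B`, as a ring whose multiplication is the `B`-convolution. -/
def ConvAlgebra (B : Type*) := SurB B → ℂ

instance (B : Type*) : AddCommGroup (ConvAlgebra B) :=
  inferInstanceAs (AddCommGroup (SurB B → ℂ))

instance (B : Type*) : Ring (ConvAlgebra B) where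
  __ := (inferInstance : AddCommGroup (ConvAlgebra B))
  mul := conv
  one := delta
  left_distrib := conv_add
  right_distrib := add_conv
  zero_mul := zero_conv
  mul_zero := conv_zero
  mul_assoc := conv_assoc
  one_mul := delta_conv
  mul_one := conv_delta

/-! ### The Möbius function -/

/-- The number of vertices and edges that are lost by a `B`-surjective morphism. -/
def rank : SurB B → ℕ :=
  Quotient.lift (fun a : SurArrow B =>
    (Nat.card a.dom.V + Nat.card a.dom.E) - (Nat.card a.cod.V + Nat.card a.cod.E)) (by
    rintro a b ⟨φ, ψ, -⟩
    simp only [Nat.card_congr (vertexEquiv φ), Nat.card_congr (vertexEquiv ψ),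
      Nat.card_congr (edgeEquiv φ), Nat.card_congr (edgeEquiv ψ)])

theorem rank_fst_add_rank_snd {η : Γ ⟶ Δ} (hη : Surj η) (d : Decomp η) :
    rank d.fst + rank d.snd = rank (SurB.mk η hη) := by
  rw [d.fst_eq, d.snd_eq]
  change (_ - _) + (_ - _) = _ - _
  have h1 := Nat.card_le_card_of_surjective _ (Quotient.out d).fst_surj.1
  have h2 := Nat.card_le_card_of_surjective _ (Quotient.out d).fst_surj.2
  have h3 := Nat.card_le_card_of_surjective _ (Quotient.out d).snd_surj.1
  have h4 := Nat.card_le_card_of_surjective _ (Quotient.out d).snd_surj.2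
  simp only
  omega

theorem isIso_of_bijective {η : Γ ⟶ Δ} (hV : Function.Bijective η.onV)
    (hE : Function.Bijective η.onE) : IsIso η := by
  obtain ⟨θ, hθ⟩ := Surj.exists_factor (f := η) ⟨hV.2, hE.2⟩ (𝟙 Γ) (fun x y h => hV.1 h)
    fun x y h => hE.1 h
  refine ⟨θ, hθ, Surj.cancel (f := η) ⟨hV.2, hE.2⟩ ?_⟩
  rw [reassoc_of% hθ, Category.comp_id]

theorem isIso_of_rank_eq_zero {η : Γ ⟶ Δ} (hη : Surj η) (h : rank (SurB.mk η hη) = 0) :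
    IsIso η := by
  change _ - _ = 0 at h
  have h1 := Nat.card_le_card_of_surjective _ hη.1
  have h2 := Nat.card_le_card_of_surjective _ hη.2
  simp only at h
  have bij : ∀ {X Y : Type} [Finite X] {f : X → Y}, Function.Surjective f →
      Nat.card X ≤ Nat.card Y → Function.Bijective f := fun {X Y} _ f hf hc => by
    have := Finite.of_surjective f hf
    exact (Nat.bijective_iff_surjective_and_card f).2
      ⟨hf, hc.antisymm (Nat.card_le_card_of_surjective f hf)⟩
  exact isIso_of_bijective (bij hη.1 (by omega)) (bij hη.2 (by omega))

/-- The difference of `δ` and the constant function `1`. -/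
def deltaSubOne (B : Type*) : ConvAlgebra B := (delta - 1 : SurB B → ℂ)

theorem one_sub_deltaSubOne (B : Type*) :
    (1 - deltaSubOne B : ConvAlgebra B) = (1 : SurB B → ℂ) :=
  sub_sub_cancel (delta : SurB B → ℂ) 1

theorem pow_deltaSubOne_apply (B : Type*) (i : ℕ) (c : SurB B) (hc : rank c < i) :
    (deltaSubOne B ^ i) c = 0 := by
  induction i generalizing c with
  | zero => exact absurd hc (Nat.not_lt_zero _)
  | succ i ih =>
    rw [pow_succ']
    induction c using Quotient.inductionOn with | h a =>
    refine (finsum_congr fun d => ?_).trans finsum_zero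
    change deltaSubOne B d.fst * (deltaSubOne B ^ i) d.snd = 0
    have hr := rank_fst_add_rank_snd a.surj d
    change _ = rank (Quotient.mk _ a) at hr
    by_cases h0 : rank d.fst = 0
    · rw [d.fst_eq] at h0 ⊢
      change (delta _ - 1) * _ = 0
      rw [delta_mk_of_isIso _ _ (isIso_of_rank_eq_zero _ h0), sub_self, zero_mul]
    · rw [ih d.snd (by omega), mul_zero]

/-- The constant function `1` is `δ - x` with `x = δ - 1`. As `x` vanishes on isomorphisms, its
`i`-th power vanishes on morphisms that lose fewer than `i` vertices and edges, so the geometric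
series of `x` is a finite sum at every morphism and inverts `1`. -/
theorem exists_isMoebius (B : Type*) : ∃ μ : SurB B → ℂ, IsMoebius μ := by
  let x := deltaSubOne B
  let S : ℕ → ConvAlgebra B := fun m => ∑ i ∈ Finset.range m, x ^ i
  let μ : SurB B → ℂ := fun c => S (rank c + 1) c
  have ev : ∀ m (c : SurB B), S m c = ∑ i ∈ Finset.range m, ((x ^ i) c : ℂ) := fun m c =>
    map_sum (AddMonoidHom.mk' (fun f : ConvAlgebra B => f c) fun _ _ => rfl)
      (fun i => x ^ i) (Finset.range m)
  have hμ : ∀ m (c : SurB B), rank c < m → μ c = S m c := by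
    intro m c hc
    change S (rank c + 1) c = _
    rw [ev, ev]
    refine Finset.sum_subset (Finset.range_subset_range.2 hc) fun i _ hi => ?_
    exact pow_deltaSubOne_apply B i c (by simpa using hi)
  refine ⟨μ, funext fun c => ?_, funext fun c => ?_⟩
  · have h1 : ((1 - x) * S (rank c + 1)) c = delta c := by
      rw [mul_neg_geom_sum]
      change delta c - (x ^ (rank c + 1)) c = _
      rw [pow_deltaSubOne_apply B _ c (Nat.lt_succ_self _), sub_zero]
    rw [one_sub_deltaSubOne] at h1
    rw [← h1]
    induction c using Quotient.inductionOn with | h a =>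
    refine finsum_congr fun d => ?_
    have hr := rank_fst_add_rank_snd a.surj d
    change _ = rank (Quotient.mk _ a) at hr
    rw [hμ (rank (Quotient.mk _ a) + 1) d.snd (by omega)]
  · have h1 : (S (rank c + 1) * (1 - x)) c = delta c := by
      rw [geom_sum_mul_neg]
      change delta c - (x ^ (rank c + 1)) c = _
      rw [pow_deltaSubOne_apply B _ c (Nat.lt_succ_self _), sub_zero]
    rw [one_sub_deltaSubOne] at h1
    rw [← h1]
    induction c using Quotient.inductionOn with | h a =>
    refine finsum_congr fun d => ?_
    have hr := rank_fst_add_rank_snd a.surj d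
    change _ = rank (Quotient.mk _ a) at hr
    rw [hμ (rank (Quotient.mk _ a) + 1) d.fst (by omega)]

theorem isMoebius_moebius (B : Type*) : IsMoebius (moebius B) :=
  Classical.epsilon_spec (exists_isMoebius B)

/-- The left Möbius derivation of `E[S_n ↷ [n]]` is the expected number of injective lifts. -/
theorem leftMoebius_eq_injE (B : Type*) (n : ℕ) : leftMoebius B n = injE B n := by
  rw [leftMoebius, permE_eq_conv, ← conv_assoc, (isMoebius_moebius B).2, delta_conv]

end Convolution

/-! ### Lifts of cycles -/

section Cycles

variable {B : Type*} [DecidableEq B] {F : Type*} [Group F] (b : FreeGroupBasis B F) {k : ℕ}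
  {w : Fin k → F}

/-- The initial segment of the `j`-th cyclic word that leads from the initial vertex of the `j`-th cycle
to the given vertex. -/
def initialWord (v : (cycleGraph b w).V) : FreeGroup B :=
  FreeGroup.mk ((cycWord b (w v.1)).take v.2)

theorem initialWord_start (hw : ∀ j, w j ≠ 1) (j : Fin k) : initialWord b (start b hw j) = 1 := rfl

theorem initialWord_mul_letter (v : (cycleGraph b w).V) :
    initialWord b v * FreeGroup.mk [letter b w v] =
      FreeGroup.mk ((cycWord b (w v.1)).take (v.2 + 1)) := by
  rw [initialWord, FreeGroup.mul_mk, List.take_succ_eq_append_getElem v.2.2]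
  rfl

theorem letter_mem_pathLabels (e : (cycleGraph b w).V) :
    FreeGroup.mk [letter b w e] ∈ (cycleGraph b w).pathLabels e (succPos b w e) := by
  cases h : (letter b w e).2 with
  | true =>
    have := of_lab_mem_pathLabels (Γ := cycleGraph b w) e
    simp only [cycleGraph, h] at this
    rwa [show letter b w e = ((letter b w e).1, true) from Prod.ext rfl h]
  | false =>
    have := inv_mem_pathLabels (of_lab_mem_pathLabels (Γ := cycleGraph b w) e)
    simp only [cycleGraph, h] at this
    rwa [show letter b w e = ((letter b w e).1, false) from Prod.ext rfl h]

theorem initialWord_mem_pathLabels (hw : ∀ j, w j ≠ 1) (v : (cycleGraph b w).V) :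
    initialWord b v ∈ (cycleGraph b w).pathLabels (start b hw v.1) v := by
  obtain ⟨j, t, ht⟩ := v
  induction t with
  | zero => exact one_mem_pathLabels _
  | succ t ih =>
    have h1 := mul_mem_pathLabels (ih (by omega)) (letter_mem_pathLabels b ⟨j, ⟨t, by omega⟩⟩)
    have h2 : succPos b w ⟨j, ⟨t, by omega⟩⟩ = ⟨j, ⟨t + 1, ht⟩⟩ :=
      congrArg (Sigma.mk j) (Fin.ext ((val_finRotate _).trans (if_neg (by simp only; omega))))
    have h3 : ∀ v, succPos b w ⟨j, ⟨t, by omega⟩⟩ = v →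
        FreeGroup.mk ((cycWord b (w j)).take (t + 1)) ∈ (cycleGraph b w).pathLabels (start b hw j) v := by
      rintro _ rfl
      rw [← initialWord_mul_letter b (w := w) ⟨j, ⟨t, by omega⟩⟩]
      exact h1
    exact h3 _ h2

/-- Along every path of the `j`-th cycle, closed up by initial segments of the cyclic word, a power of the
cyclic word is read. -/
theorem initialWord_mul_mem_zpowers {u v : (cycleGraph b w).V} {g : FreeGroup B}
    (hg : g ∈ (cycleGraph b w).pathLabels u v) :
    u.1 = v.1 ∧ initialWord b u * g * (initialWord b v)⁻¹ ∈
      Subgroup.zpowers (FreeGroup.mk (cycWord b (w u.1))) := by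
  have step : ∀ e : (cycleGraph b w).V,
      initialWord b e * FreeGroup.mk [letter b w e] * (initialWord b (succPos b w e))⁻¹ ∈
        Subgroup.zpowers (FreeGroup.mk (cycWord b (w e.1))) := by
    intro e
    rw [initialWord_mul_letter]
    have h := val_finRotate e.2
    change _ * (FreeGroup.mk ((cycWord b (w e.1)).take (finRotate _ e.2)))⁻¹ ∈ _
    rw [h]
    split_ifs with h1
    · rw [h1, List.take_length, List.take_zero, ← FreeGroup.one_eq_mk, inv_one, mul_one]
      exact Subgroup.mem_zpowers _
    · rw [mul_inv_cancel]
      exact one_mem _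
  have edge : ∀ e : (cycleGraph b w).E,
      ((cycleGraph b w).src e).1 = e.1 ∧ ((cycleGraph b w).tgt e).1 = e.1 ∧
      initialWord b ((cycleGraph b w).src e) * FreeGroup.of ((cycleGraph b w).lab e) *
        (initialWord b ((cycleGraph b w).tgt e))⁻¹ ∈
        Subgroup.zpowers (FreeGroup.mk (cycWord b (w e.1))) := by
    intro e
    have h1 := step e
    refine ⟨?_, ?_, ?_⟩
    · exact (apply_ite Sigma.fst _ _ _).trans (ite_self e.1)
    · exact (apply_ite Sigma.fst _ _ _).trans (ite_self e.1)
    cases h : (letter b w e).2 with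
    | true =>
      simp only [cycleGraph, h]
      rwa [show letter b w e = ((letter b w e).1, true) from Prod.ext rfl h] at h1
    | false =>
      simp only [cycleGraph, h]
      rw [show letter b w e = ((letter b w e).1, false) from Prod.ext rfl h, mk_cons_false,
        ← FreeGroup.one_eq_mk, mul_one] at h1
      have h2 := inv_mem h1
      rwa [mul_inv_rev, mul_inv_rev, inv_inv, inv_inv, ← mul_assoc] at h2
  refine pathLabels_induction (P := fun (u v : (cycleGraph b w).V) g => u.1 = v.1 ∧
    initialWord b u * g * (initialWord b v)⁻¹ ∈ Subgroup.zpowers (FreeGroup.mk (cycWord b (w u.1))))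
    (fun v => ⟨rfl, ?_⟩) (fun e v g hg ih => ?_) (fun e v g hg ih => ?_) hg
  · rw [mul_one, mul_inv_cancel]
    exact one_mem _
  · obtain ⟨h1, h2, h3⟩ := edge e
    obtain ⟨h4, h5⟩ := ih
    rw [h2] at h4 h5
    rw [h1]
    refine ⟨h4, ?_⟩
    convert mul_mem h3 h5 using 1
    group
  · obtain ⟨h1, h2, h3⟩ := edge e
    obtain ⟨h4, h5⟩ := ih
    rw [h1] at h4 h5
    rw [h2]
    refine ⟨h4, ?_⟩
    convert mul_mem (inv_mem h3) h5 using 1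
    group

theorem bijective_comp_start (hw : ∀ j, w j ≠ 1) :
    Function.Bijective fun j => (cycleGraph b w).comp (start b hw j) := by
  constructor
  · intro j j' h
    obtain ⟨g, hg⟩ := comp_eq_iff.1 h
    exact (initialWord_mul_mem_zpowers b hg).1
  · intro c
    refine ⟨((cycleGraph b w).base c).1, ?_⟩
    exact (comp_eq_iff.2 ⟨_, initialWord_mem_pathLabels b hw _⟩).trans (comp_base c)

/-- A lift of the cycles is given by a choice, for every `j`, of a fixed point of the holonomy of
the `j`-th word. -/
theorem bijective_lift_start (hw : ∀ j, w j ≠ 1) {n : ℕ}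
    (σ : (cycleGraph b w).E → Equiv.Perm (Fin n)) :
    Function.Bijective fun f : {f // IsLift σ f} => (fun j => ⟨f.1 (start b hw j),
      f.2.hol_apply (loop b hw j).2⟩ :
        ∀ j, {p : Fin n // hol σ (start b hw j) (loop b hw j) p = p}) := by
  have hbij := bijective_lift_comp (bijective_comp_start b hw) σ
  constructor
  · intro f f' h
    refine hbij.1 (funext fun j => Subtype.ext ?_)
    have hj : f.1 (start b hw j) = f'.1 (start b hw j) := congrArg Subtype.val (congrFun h j)
    exact hj
  · intro p
    have hp : ∀ j, ∀ g ∈ (cycleGraph b w).pi1 (start b hw j),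
        hol σ (start b hw j) g (p j) = p j := by
      intro j g hg
      obtain ⟨m, hm⟩ := (initialWord_mul_mem_zpowers b hg).2
      rw [initialWord_start, one_mul, inv_one, mul_one] at hm
      have h1 : (⟨g, hg⟩ : (cycleGraph b w).pi1 (start b hw j)) = loop b hw j ^ m :=
        Subtype.ext hm.symm
      change holHom σ (start b hw j) ⟨g, hg⟩ (p j) = p j
      rw [h1, map_zpow]
      exact Equiv.Perm.zpow_apply_eq_self_of_apply_eq_self (p j).2 m
    obtain ⟨f, hf⟩ := hbij.2 fun j => ⟨(p j).1, hp j⟩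
    have hf' : ∀ j, f.1 (start b hw j) = p j := fun j => congrArg Subtype.val (congrFun hf j)
    exact ⟨f, funext fun j => Subtype.ext (hf' j)⟩

/-! ### Expectations of induced class functions -/

variable (hw : ∀ j, w j ≠ 1) {G : Type*} [Group G]

theorem wordExpect_eq_avg [Finite G] {Δ : MultiCoreGraph B} (η : cycleGraph b w ⟶ Δ)
    (ζ : Fin k → ClassFn G) :
    wordExpect b hw η ζ = avg fun x : Δ.E → G =>
      ∏ j, ζ j (hol (x ∘ η.onE) (start b hw j) (loop b hw j)) := by
  rw [wordExpect, homExpect_eq_avg _ _ _ _ fun j g α => (ζ j).2 _ _]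
  refine congrArg avg (funext fun x => Finset.prod_congr rfl fun j _ => ?_)
  rw [hol_comp_onE η x (loop b hw j).2]
  rfl

/-- The product of the induced class functions at the holonomies of the cycles is a sum over the
lifts of the cycles of the products of the original class functions at the holonomies in `G`. -/
theorem prod_ind_hol (ζ : Fin k → ClassFn G) {n : ℕ} (x : (cycleGraph b w).E → Wreath G n) :
    ∏ j, (ζ j).ind n (hol x (start b hw j) (loop b hw j)) =
      ∑ᶠ f : {f // IsLift (fun e => (x e).right) f}, ∏ j,
        ζ j (hol (fun e => (x e).left (f.1 ((cycleGraph b w).src e)))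
          (start b hw j) (loop b hw j)) := by
  classical
  have hright : ∀ j, (hol x (start b hw j) (loop b hw j)).right =
      hol (fun e => (x e).right) (start b hw j) (loop b hw j) := fun j =>
    (hol_monoidHom (SemidirectProduct.rightHom : Wreath G n →* _) x (loop b hw j).2).symm
  let ψ : ∀ j, {p : Fin n // hol (fun e => (x e).right) (start b hw j) (loop b hw j) p = p} → ℂ :=
    fun j p => ζ j ((hol x (start b hw j) (loop b hw j)).left p)
  have hind : ∀ j, (ζ j).ind n (hol x (start b hw j) (loop b hw j)) = ∑ p, ψ j p := by
    intro j
    change ∑ i : Fin n with _ = _, _ = _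
    rw [hright]
    exact Finset.sum_subtype _ (fun i => by simp) _
  rw [Finset.prod_congr rfl fun j _ => hind j, Fintype.prod_sum, ← finsum_eq_sum_of_fintype]
  refine (finsum_eq_of_bijective _ (bijective_lift_start b hw _) fun f => ?_).symm
  refine Finset.prod_congr rfl fun j _ => ?_
  rw [f.2.hol_left (loop b hw j).2]

/-- For a random labelling by the wreath product, condition on its permutation part `σ`. The
`G`-components are independent labels on the edges of the cover defined by `σ`. A lift of the
cycles sees only the labels on its image `Σ`, so it contributes the expectation of the original
class functions along `Γ_B(w) ↠ Σ`, and `Σ` is counted once for each of its injective lifts. -/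
theorem wordExpect_ind [Finite G] {Δ : MultiCoreGraph B} (η : cycleGraph b w ⟶ Δ) (hη : Surj η)
    (ζ : Fin k → ClassFn G) (n : ℕ) :
    wordExpect b hw η (fun j => (ζ j).ind n) =
      ∑ᶠ d : Decomp η, wordE b hw ζ d.fstQ * injE B n d.snd := by
  have : Finite (Wreath G n) := Finite.of_equiv _ SemidirectProduct.equivProd.symm
  have := Fintype.ofFinite (Decomp η)
  have := fun (d : Decomp η) (σ : Δ.E → Equiv.Perm (Fin n)) =>
    Fintype.ofFinite {g // IsInjLift (Quotient.out d).snd σ g}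
  let e : (Δ.E → Wreath G n) ≃ (Δ.E → Equiv.Perm (Fin n)) × (Δ.E → Fin n → G) :=
    ⟨fun x => (fun e => (x e).right, fun e => (x e).left), fun p e => ⟨p.2 e, p.1 e⟩,
      fun _ => rfl, fun _ => rfl⟩
  let P : (Δ.E → Equiv.Perm (Fin n)) → (Δ.E → Fin n → G) → ℂ := fun σ y =>
    ∑ᶠ f : {f // IsLift (σ ∘ η.onE) f}, ∏ j,
      ζ j (hol (fun e => y (η.onE e) (f.1 ((cycleGraph b w).src e)))
        (start b hw j) (loop b hw j))
  have key : ∀ σ, avg (P σ) = ∑ d : Decomp η,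
      (Nat.card {g // IsInjLift (Quotient.out d).snd σ g} : ℂ) * wordE b hw ζ d.fstQ := by
    intro σ
    -- the contribution of an injective lift `g` of the second map of a decomposition
    let Q : (p : Σ d : Decomp η, {g // IsInjLift (Quotient.out d).snd σ g}) →
        (Δ.E → Fin n → G) → ℂ := fun p y => ∏ j,
      ζ j (hol (fun e => y (η.onE e) (p.2.1 ((Quotient.out p.1).fst.onV
        ((cycleGraph b w).src e)))) (start b hw j) (loop b hw j))
    have hP : P σ = fun y => ∑ p, Q p y := by
      funext y
      rw [← finsum_eq_sum_of_fintype]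
      exact (finsum_eq_of_bijective _ (bijective_injLift_comp hη σ) fun p => rfl).symm
    have hQ : ∀ p, avg (Q p) = wordE b hw ζ p.1.fstQ := by
      rintro ⟨d, g, hg⟩
      let i : (Quotient.out d).mid.E → Δ.E × Fin n := fun e =>
        ((Quotient.out d).snd.onE e, g ((Quotient.out d).mid.src e))
      have hi : Function.Injective i := by
        intro e e' h
        obtain ⟨h1, h2⟩ := Prod.mk.inj h
        refine (Quotient.out d).mid.src_inj _ _ (hg.2 (Prod.ext ?_ h2)) ?_
        · simp only [← Hom.src_comm, h1]
        · rw [← (Quotient.out d).snd.lab_comm, h1, (Quotient.out d).snd.lab_comm]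
      rw [d.fstQ_eq]
      change _ = wordExpect b hw (Quotient.out d).fst ζ
      rw [wordExpect_eq_avg, ← avg_comp_injective hi]
      refine avg_equiv (Equiv.curry _ _ _).symm _ _ fun y => ?_
      refine Finset.prod_congr rfl fun j _ => ?_
      refine congrArg (fun z => ζ j (hol z (start b hw j) (loop b hw j))) (funext fun e => ?_)
      change y _ _ = y _ (g _)
      rw [← Hom.src_comm]
      exact congrFun (congrArg y (congrFun (congrArg Hom.onE (Quotient.out d).fac) e).symm) _
    rw [hP, avg_sum, Fintype.sum_sigma]
    refine Finset.sum_congr rfl fun d _ => ?_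
    refine (Finset.sum_congr rfl fun g _ => hQ ⟨d, g⟩).trans ?_
    change ∑ _g : {g // IsInjLift (Quotient.out d).snd σ g}, wordE b hw ζ d.fstQ = _
    rw [Finset.sum_const, nsmul_eq_mul, Finset.card_univ, Nat.card_eq_fintype_card]
  have hx : ∀ x : Δ.E → Wreath G n, ∏ j, (ζ j).ind n
      (hol (x ∘ η.onE) (start b hw j) (loop b hw j)) = P (e x).1 (e x).2 := fun x =>
    prod_ind_hol b hw ζ (x ∘ η.onE)
  rw [wordExpect_eq_avg, avg_equiv e _ (fun p => P p.1 p.2) hx, avg_prod]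
  simp only [key]
  rw [avg_sum, finsum_eq_sum_of_fintype]
  refine Finset.sum_congr rfl fun d _ => ?_
  rw [avg_mul_const, mul_comm, injE_snd]
  rfl

end Cycles

end MultiCoreGraph

end ICL

end

theorem lemma4p1 {r : ℕ} {F : Type*} [Group F] (b : FreeGroupBasis (Fin r) F)
    {k : ℕ} (w : Fin k → F) (hw : ∀ j, w j ≠ 1)
    (G : Type*) [Group G] [Finite G] (ζ : Fin k → ClassFn G) (n : ℕ) :
    IsMoebius (moebius (Fin r)) ∧
    wordE b hw (fun j => (ζ j).ind n) =
      convQ (convQ (wordE b hw ζ) (moebius (Fin r))) (permE (Fin r) n) ∧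
    ∀ (Δ : MultiCoreGraph (Fin r)) (η : cycleGraph b w ⟶ Δ), Surj η →
      wordExpect b hw η (fun j => (ζ j).ind n) =
        ∑ᶠ d : Decomp η, wordE b hw ζ d.fstQ * leftMoebius (Fin r) n d.snd := by
  have main : ∀ (Δ : MultiCoreGraph (Fin r)) (η : cycleGraph b w ⟶ Δ), Surj η →
      wordExpect b hw η (fun j => (ζ j).ind n) =
        ∑ᶠ d : Decomp η, wordE b hw ζ d.fstQ * leftMoebius (Fin r) n d.snd := by
    intro Δ η hη
    rw [leftMoebius_eq_injE]
    exact wordExpect_ind b hw η hη ζ n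
  refine ⟨isMoebius_moebius _, ?_, main⟩
  rw [convQ_assoc]
  funext c
  induction c using Quotient.inductionOn with | h a =>
  exact main a.cod a.hom a.surj
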